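/- Let $H\in(0,1)$, $H\neq\tfrac12$, and let $(Z_{h}(t))_{(t,h)\in[0,\infty)\times(0,1)}$ be a fractional Gaussian field on a probability space $(\Omega,\mathcal F,\mathbb P)$, i.e. a centered Gaussian field with $$\mathbb E[Z_h(t)Z_{h'}(s)]=\tfrac{a_{h,h'}}{2}\left(t^{h+h'}+s^{h+h'}-|t-s|^{h+h'}\right),$$ where $a_{h,h'}=\sqrt{\Gamma(2h+1)\Gamma(3-2h)}\,\sin^2(\pi h)$ if $h+h'=1$, and otherwise $$a_{h,h'}=-\tfrac2\pi\sqrt{\Gamma(2h+1)\sin(\pi h)}\sqrt{\Gamma(2h'+1)\sin(\pi h')}\;\Gamma(-(h+h'))\cos\!\left((h'-h)\tfrac\pi2\right)\cos\!\left((h+h')\tfrac\pi2\right).$$ Put $\mathcal F^H_t=\sigma(Z_H(r):0\le r\le t)$, let $(M_t)_{t\ge0}$ be a version with almost surely continuous paths of the process $\mathbb E[Z_{1-H}(t)\mid\mathcal F^H_t]$, and set, with $a_H=a_{H,1-H}$, $$c_M=\frac{a_H^2\,\Gamma(\frac32-H)}{2H\,\Gamma(H+\frac12)\Gamma(3-2H)},\qquad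 c_\Psi=\frac{2H\,\Gamma(3-2H)\Gamma(H+\frac12)}{a_H\,\Gamma(\frac32-H)},\qquad C=c_\Psi\sqrt{c_M(2-2H)}.$$ Then there is a Brownian motion $W$ adapted to the completion of $(\mathcal F^H_t)_{t\ge 0}$ such that, for every $t\ge0$, almost surely $$M_t=\sqrt{c_M(2-2H)}\int_0^t s^{1/2-H}\,dW_s$$ (here a Brownian motion is any process with the finite-dimensional distributions of standard Brownian motion; continuity of its paths is not required). For every such $W$ and every $\epsilon>0$, the modified Dobrić–Ojeda process $$V^\epsilon_t=C\int_0^t s^{H-1/2}\,dW_s+\int_0^t c_\Psi(2H-1)s^{2H-2}M_s\mathbf 1_{[\epsilon,\infty)}(s)\,ds$$ is square integrable and satisfies, for all $t\ge0$, $$\mathbb E[V^\epsilon_t]=0$$ and $$\mathbb E[(V^\epsilon_t)^2]=\begin{cases}\dfrac{C^2t^{2H}}{2H}, & t\le\epsilon,\\[2ex] \dfrac{C^2}{2H}t^{2H}+2C^2(2H-1)\dfrac1{2H}\left(t^{2H}-\epsilon^{2H}\right)+2c_Mc_\Psi^2(2H-1)^2\left(\dfrac1{2H}\left(t^{2H}-\epsilon^{2H}\right)-\dfrac{\epsilon}{2H-1}\left(t^{2H-1}-\epsilon^{2H-1}\right)\right),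 & t>\epsilon.\end{cases}$$ -/

import Mathlib

open MeasureTheory ProbabilityTheory Filter
open scoped NNReal ENNReal Topology

noncomputable section

namespace DobricOjeda

/-- The set of Hurst indices, the open interval `(0, 1)`. -/
abbrev Hurst : Type := Set.Ioo (0 : ℝ) 1

/-- The dual Hurst index `H' = 1 - H`. -/
def Hurst.dual (H : Hurst) : Hurst :=
  ⟨1 - (H : ℝ), by linarith [H.2.2], by linarith [H.2.1]⟩

/-- The constant `a_{H,H'}` in the covariance of the fractional Gaussian field. -/
def fieldConst (H H' : ℝ) : ℝ :=
  if H + H' = 1 then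
    √(Real.Gamma (2 * H + 1) * Real.Gamma (3 - 2 * H)) * Real.sin (Real.pi * H) ^ 2
  else
    -(2 / Real.pi) * √(Real.Gamma (2 * H + 1) * Real.sin (Real.pi * H))
      * √(Real.Gamma (2 * H' + 1) * Real.sin (Real.pi * H'))
      * Real.Gamma (-(H + H')) * Real.cos ((H' - H) * (Real.pi / 2))
      * Real.cos ((H + H') * (Real.pi / 2))

/-- The constant `a_H = a_{H,1-H}`. -/
def aConst (H : ℝ) : ℝ := fieldConst H (1 - H)

/-- The constant `c_M = a_H² Γ(3/2 - H) / (2H Γ(H + 1/2) Γ(3 - 2H))`. -/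
def cM (H : ℝ) : ℝ :=
  aConst H ^ 2 * Real.Gamma (3 / 2 - H)
    / (2 * H * Real.Gamma (H + 1 / 2) * Real.Gamma (3 - 2 * H))

/-- The constant `c_Ψ = 2H Γ(3 - 2H) Γ(H + 1/2) / (a_H Γ(3/2 - H))`. -/
def cPsi (H : ℝ) : ℝ :=
  2 * H * Real.Gamma (3 - 2 * H) * Real.Gamma (H + 1 / 2)
    / (aConst H * Real.Gamma (3 / 2 - H))

/-- The constant `C = c_Ψ √(c_M (2 - 2H))`. -/
def diffusionConst (H : ℝ) : ℝ := cPsi H * √(cM H * (2 - 2 * H))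

variable {Ω : Type*} [MeasurableSpace Ω]

/-- `Z = (Z_H(t))` is a fractional Gaussian field: a centered Gaussian field, indexed by
`H ∈ (0, 1)` and `t ∈ [0, ∞)`, with
`E[Z_H(t) Z_{H'}(s)] = (a_{H,H'} / 2) (t^{H+H'} + s^{H+H'} - |t - s|^{H+H'})`. -/
structure IsFractionalGaussianField (Z : Hurst → ℝ≥0 → Ω → ℝ) (P : Measure Ω) : Prop where
  measurable : ∀ H t, Measurable (Z H t)
  gaussian : IsGaussianProcess (fun p : Hurst × ℝ≥0 ↦ Z p.1 p.2) P
  centered : ∀ H t, ∫ ω, Z H t ω ∂P = 0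
  covariance : ∀ (H H' : Hurst) (t s : ℝ≥0),
    ∫ ω, Z H t ω * Z H' s ω ∂P =
      fieldConst H H' / 2 * ((t : ℝ) ^ ((H : ℝ) + H') + (s : ℝ) ^ ((H : ℝ) + H')
        - |(t : ℝ) - s| ^ ((H : ℝ) + H'))

/-- The σ-algebra `F_t^H = σ(Z_H(r) : 0 ≤ r ≤ t)`. -/
abbrev sigmaField (Z : Hurst → ℝ≥0 → Ω → ℝ) (H : Hurst) (t : ℝ≥0) : MeasurableSpace Ω :=
  ⨆ r : ℝ≥0, ⨆ _ : r ≤ t, MeasurableSpace.comap (Z H r) inferInstance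

/-- `M` is a continuous version of the process `M_H(t) = E[Z_{1-H}(t) | F_t^H]`. -/
structure IsProjectedMartingale (Z : Hurst → ℝ≥0 → Ω → ℝ) (P : Measure Ω) (H : Hurst)
    (M : ℝ≥0 → Ω → ℝ) : Prop where
  ae_eq_condExp : ∀ t, M t =ᵐ[P] P[Z H.dual t | sigmaField Z H t]
  continuous_paths : ∀ᵐ ω ∂P, Continuous fun t ↦ M t ω

/-- Data for a step function on `[0, ∞)`: the value is `val i` on `(knot i, knot (i + 1)]` for
`i < n`, and zero elsewhere. -/
structure StepData where
  n : ℕ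
  knot : ℕ → ℝ≥0
  mono : Monotone knot
  val : ℕ → ℝ

/-- The step function `∑ᵢ vᵢ 1_{(τᵢ, τᵢ₊₁]}`. -/
def StepData.toFun (g : StepData) (s : ℝ) : ℝ :=
  ∑ i ∈ Finset.range g.n,
    (Set.Ioc (g.knot i : ℝ) (g.knot (i + 1) : ℝ)).indicator (fun _ ↦ g.val i) s

/-- The elementary stochastic integral `∑ᵢ vᵢ (W_{τᵢ₊₁} - W_{τᵢ})`. -/
def StepData.integral (g : StepData) (W : ℝ≥0 → Ω → ℝ) (ω : Ω) : ℝ :=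
  ∑ i ∈ Finset.range g.n, g.val i * (W (g.knot (i + 1)) ω - W (g.knot i) ω)

/-- `I` is (a version of) the Itô integral `∫_0^t f(s) dW_s` of the deterministic integrand `f`:
the `L²(P)`-limit of the elementary integrals of step functions on `[0, t]` that converge to `f`
in `L²([0, t])`. -/
structure IsWienerIntegral (W : ℝ≥0 → Ω → ℝ) (P : Measure Ω) (f : ℝ → ℝ) (t : ℝ≥0)
    (I : Ω → ℝ) : Prop where
  memLp : MemLp I 2 P
  approx : ∃ g : ℕ → StepData, (∀ k i, (g k).knot i ≤ t) ∧
    Tendsto (fun k ↦ eLpNorm (fun s ↦ f s - (g k).toFun s) 2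
      (volume.restrict (Set.Ioc (0 : ℝ) t))) atTop (𝓝 0) ∧
    Tendsto (fun k ↦ eLpNorm (fun ω ↦ I ω - (g k).integral W ω) 2 P) atTop (𝓝 0)

open Classical in
/-- The Itô integral `∫_0^t f(s) dW_s` of a deterministic `f ∈ L²([0, t])`. (When `W` is a
Brownian motion it exists and is unique up to almost sure equality; in all other cases where no
such limit exists the value is `0`.) -/
def wienerIntegral (W : ℝ≥0 → Ω → ℝ) (P : Measure Ω) (f : ℝ → ℝ) (t : ℝ≥0) : Ω → ℝ :=
  if h : ∃ I, IsWienerIntegral W P f t I then h.choose else 0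

/-- `W` is a Brownian motion, adapted to the (completed) filtration `(F_t^H)`, that drives `M`:
`dM_t = √(c_M (2 - 2H)) t^{1/2 - H} dW_t`, `M_0 = 0`. Only the law of `W` matters, so continuity
of its paths is not asked for. -/
structure IsDrivingBrownianMotion (Z : Hurst → ℝ≥0 → Ω → ℝ) (P : Measure Ω) (H : Hurst)
    (M W : ℝ≥0 → Ω → ℝ) : Prop where
  brownian : IsPreBrownianReal W P
  adapted : ∀ t, AEStronglyMeasurable[sigmaField Z H t] (W t) P
  drives : ∀ t, M t =ᵐ[P] fun ω ↦
    √(cM H * (2 - 2 * (H : ℝ))) * wienerIntegral W P (fun s ↦ s ^ (1 / 2 - (H : ℝ))) t ω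

/-- The modified Dobrić–Ojeda process started at `0`,
`dV_t^ε = C t^{H-1/2} dW_t + c_Ψ (2H - 1) t^{2H-2} M_t 1_{[ε,∞)}(t) dt`. -/
def modifiedProcess (P : Measure Ω) (H : Hurst) (M W : ℝ≥0 → Ω → ℝ) (ε : ℝ) (t : ℝ≥0)
    (ω : Ω) : ℝ :=
  diffusionConst H * wienerIntegral W P (fun s ↦ s ^ ((H : ℝ) - 1 / 2)) t ω
    + ∫ s in Set.Ioc (0 : ℝ) t, (Set.Ici ε).indicator
        (fun s ↦ cPsi H * (2 * (H : ℝ) - 1) * s ^ (2 * (H : ℝ) - 2) * M s.toNNReal ω) s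

end DobricOjeda

end

open MeasureTheory ProbabilityTheory Filter
open scoped NNReal ENNReal Topology

noncomputable section

namespace DobricOjeda

/-! The argument takes place in `L²(P)`. Since `a_{H,H} = 1`, the process `Z_H` is a fractional
Brownian motion. Since the indices `H` and `1 - H` add up to one, `E[Z_{1-H}(t) Z_H(r)] = a_H r` for
`r ≤ t`. In a Gaussian field, conditioning on the past is orthogonal projection onto its closed span
(`condExp_eq_of_orthogonal`). So `M_t` is the vector of that span which represents `Z_H(r) ↦ a_H r`.

By self-similarity it suffices to find this vector for a fractional Brownian motion `X` on `[0, 1]`.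
Up to a constant it is the classical fundamental martingale `∫ (s(1-s))^{1/2-H} dX_s`, defined here
by integration by parts against the bridge `X_s - s X_1` (`exists_fundamental_vector`). That it
works amounts to one fact: with `a = 1/2 - H`, the integral of `(s(1-s))^a sign(s-r) |s-r|^{-2a}`
over `[0, 1]` is an affine function of `r` (`integral_weight_mul_signedPow`). This comes from a
first-order differential equation for Euler's hypergeometric integral whose right side is symmetric
under `r ↦ 1 - r`.

The past spans are nested, so `E[M_s M_t] = c_M min(s,t)^{2-2H}` (`exists_martingaleLp`). Hence `M`
has orthogonal increments with variance density `c_M (2-2H) s^{1-2H}`, and dividing by the square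
root of this density gives the Brownian motion `W` (`exists_driving`).

For the moments, `V^ε_t` is written as a sum of two vectors of `L²`: a Wiener integral, and a
Bochner integral of the martingale, which a Fubini argument identifies with the pathwise one. The
integrands `s^{H-1/2}` and `s^{1/2-H}` are reciprocal, so their Itô pairing is linear in time.
Expanding the square leaves elementary integrals of powers. -/

/-! ### Beta and Euler integrals -/

theorem intervalIntegrable_rpow_mul_one_sub_rpow {p q : ℝ} (hp : -1 < p) (hq : -1 < q) :
    IntervalIntegrable (fun u : ℝ ↦ u ^ p * (1 - u) ^ q) volume 0 1 := by
  have h := Complex.betaIntegral_convergent (u := ((p + 1 : ℝ) : ℂ)) (v := ((q + 1 : ℝ) : ℂ))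
    (by rw [Complex.ofReal_re]; linarith) (by rw [Complex.ofReal_re]; linarith)
  rw [intervalIntegrable_iff_integrableOn_Ioo_of_le zero_le_one] at h ⊢
  refine IntegrableOn.congr_fun (f := fun x : ℝ ↦ RCLike.re
    ((x : ℂ) ^ (((p + 1 : ℝ) : ℂ) - 1) * (1 - (x : ℂ)) ^ (((q + 1 : ℝ) : ℂ) - 1))) h.re
    (fun u hu ↦ ?_) measurableSet_Ioo
  have h1 : (u : ℂ) ^ (((p + 1 : ℝ) : ℂ) - 1) = ((u ^ p : ℝ) : ℂ) := by
    rw [Complex.ofReal_cpow hu.1.le]; congr 1; push_cast; ring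
  have h2 : (1 - (u : ℂ)) ^ (((q + 1 : ℝ) : ℂ) - 1) = (((1 - u) ^ q : ℝ) : ℂ) := by
    rw [Complex.ofReal_cpow (by linarith [hu.2])]; congr 1 <;> push_cast <;> ring
  simp only [h1, h2, ← Complex.ofReal_mul]
  exact Complex.ofReal_re _

theorem integral_rpow_mul_one_sub_rpow {p q : ℝ} (hp : -1 < p) (hq : -1 < q) :
    ∫ u in (0 : ℝ)..1, u ^ p * (1 - u) ^ q = beta (p + 1) (q + 1) := by
  have h : Complex.betaIntegral ((p + 1 : ℝ) : ℂ) ((q + 1 : ℝ) : ℂ)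
      = ((∫ u in (0 : ℝ)..1, u ^ p * (1 - u) ^ q : ℝ) : ℂ) := by
    rw [Complex.betaIntegral, ← intervalIntegral.integral_ofReal,
      intervalIntegral.integral_of_le zero_le_one, intervalIntegral.integral_of_le zero_le_one,
      integral_Ioc_eq_integral_Ioo, integral_Ioc_eq_integral_Ioo]
    refine setIntegral_congr_fun measurableSet_Ioo fun u hu ↦ ?_
    have h1 : (u : ℂ) ^ (((p + 1 : ℝ) : ℂ) - 1) = ((u ^ p : ℝ) : ℂ) := by
      rw [Complex.ofReal_cpow hu.1.le]; congr 1; push_cast; ring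
    have h2 : (1 - (u : ℂ)) ^ (((q + 1 : ℝ) : ℂ) - 1) = (((1 - u) ^ q : ℝ) : ℂ) := by
      rw [Complex.ofReal_cpow (by linarith [hu.2])]; congr 1 <;> push_cast <;> ring
    simp only [h1, h2, ← Complex.ofReal_mul]
  rw [beta_eq_betaIntegralReal _ _ (by linarith) (by linarith), h, Complex.ofReal_re]

/-- A power of `x` on `[δ, D]` is at most the sum of the powers of the end points. -/
theorem rpow_le_rpow_add_rpow {δ D x : ℝ} (hδ : 0 < δ) (h1 : δ ≤ x) (h2 : x ≤ D) (c : ℝ) :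
    x ^ c ≤ δ ^ c + D ^ c := by
  have hx := hδ.trans_le h1
  rcases le_total 0 c with hc | hc
  · have := Real.rpow_le_rpow hx.le h2 hc
    have := Real.rpow_nonneg hδ.le c
    linarith
  · have := Real.rpow_le_rpow_of_nonpos hδ h1 hc
    have := Real.rpow_nonneg (hx.le.trans h2) c
    linarith

/-- Euler's integral `∫_0^1 u^p (1-u)^q (1-ru)^b du`. -/
def eulerIntegral (p q b r : ℝ) : ℝ :=
  ∫ u in (0 : ℝ)..1, u ^ p * (1 - u) ^ q * (1 - r * u) ^ b

theorem aestronglyMeasurable_euler (p q b r : ℝ) (μ : Measure ℝ) :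
    AEStronglyMeasurable (fun u : ℝ ↦ u ^ p * (1 - u) ^ q * (1 - r * u) ^ b) μ := by
  have : Measurable (fun u : ℝ ↦ u ^ p * (1 - u) ^ q * (1 - r * u) ^ b) := by fun_prop
  exact this.aestronglyMeasurable

theorem one_sub_mul_mem {ρ r u : ℝ} (hr : |r| ≤ ρ) (hρ : ρ < 1) (hu0 : 0 ≤ u) (hu1 : u ≤ 1) :
    1 - ρ ≤ 1 - r * u ∧ 1 - r * u ≤ 2 := by
  have h : |r * u| ≤ ρ := by
    rw [abs_mul, abs_of_nonneg hu0]
    nlinarith [abs_nonneg r]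
  have := abs_le.1 h
  constructor <;> linarith

theorem intervalIntegrable_euler {p q : ℝ} (hp : -1 < p) (hq : -1 < q) (b : ℝ) {r : ℝ}
    (hr : |r| < 1) :
    IntervalIntegrable (fun u : ℝ ↦ u ^ p * (1 - u) ^ q * (1 - r * u) ^ b) volume 0 1 := by
  refine ((intervalIntegrable_rpow_mul_one_sub_rpow hp hq).mul_const
    ((1 - |r|) ^ b + 2 ^ b)).mono_fun (aestronglyMeasurable_euler _ _ _ _ _) ?_
  rw [Filter.EventuallyLE, ae_restrict_iff' measurableSet_uIoc]
  refine ae_of_all _ fun u hu ↦ ?_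
  rw [Set.uIoc_of_le zero_le_one] at hu
  obtain ⟨h1, h2⟩ := one_sub_mul_mem le_rfl hr hu.1.le hu.2
  have h3 := rpow_le_rpow_add_rpow (by linarith) h1 h2 b
  have h4 : 0 ≤ (1 - r * u) ^ b := Real.rpow_nonneg (by linarith) _
  rw [norm_mul _ ((1 - r * u) ^ b), norm_mul _ (_ + _), Real.norm_of_nonneg h4,
    Real.norm_of_nonneg (h4.trans h3)]
  gcongr

theorem hasDerivAt_eulerIntegral {p q : ℝ} (hp : -1 < p) (hq : -1 < q) (b : ℝ) {r : ℝ}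
    (hr : |r| < 1) :
    HasDerivAt (eulerIntegral p q b) (-b * eulerIntegral (p + 1) q (b - 1) r) r := by
  -- For `|x| < ρ < 1` the factor `1 - x u` stays in `[1 - ρ, 2]`. The sign of `b - 1` is unknown,
  -- so the dominating function adds the powers of both end points.
  obtain ⟨ρ, hρ1, hρ2⟩ := exists_between hr
  have hs : Set.Ioo (-ρ) ρ ∈ 𝓝 r := by
    have := abs_lt.1 hρ1
    exact Ioo_mem_nhds this.1 this.2
  have key := (intervalIntegral.hasDerivAt_integral_of_dominated_loc_of_deriv_le (μ := volume)
    (a := 0) (b := 1) (F := fun r u : ℝ ↦ u ^ p * (1 - u) ^ q * (1 - r * u) ^ b)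
    (F' := fun r u : ℝ ↦ -b * (u ^ (p + 1) * (1 - u) ^ q * (1 - r * u) ^ (b - 1)))
    (bound := fun u ↦ |b| * (u ^ (p + 1) * (1 - u) ^ q * ((1 - ρ) ^ (b - 1) + 2 ^ (b - 1))))
    hs (Eventually.of_forall fun r ↦ aestronglyMeasurable_euler _ _ _ _ _)
    (intervalIntegrable_euler hp hq b hr)
    ((aestronglyMeasurable_euler _ _ _ _ _).const_mul _) ?_ ?_ ?_).2
  · rw [intervalIntegral.integral_const_mul] at key
    exact key
  · refine ae_of_all _ fun u hu x hx ↦ ?_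
    rw [Set.uIoc_of_le zero_le_one] at hu
    obtain ⟨h1, h2⟩ := one_sub_mul_mem (abs_lt.2 hx).le hρ2 hu.1.le hu.2
    have h3 := rpow_le_rpow_add_rpow (by linarith) h1 h2 (b - 1)
    have h4 : 0 ≤ (1 - x * u) ^ (b - 1) := Real.rpow_nonneg (by linarith) _
    have h5 : 0 ≤ u ^ (p + 1) := Real.rpow_nonneg hu.1.le _
    have h6 : 0 ≤ (1 - u) ^ q := Real.rpow_nonneg (by linarith [hu.2]) _
    rw [norm_mul, norm_neg, Real.norm_eq_abs b, Real.norm_of_nonneg (by positivity)]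
    gcongr
  · exact (((intervalIntegrable_rpow_mul_one_sub_rpow (by linarith) hq).mul_const _).const_mul _)
  · refine ae_of_all _ fun u hu x hx ↦ ?_
    rw [Set.uIoc_of_le zero_le_one] at hu
    obtain ⟨h1, h2⟩ := one_sub_mul_mem (abs_lt.2 hx).le hρ2 hu.1.le hu.2
    have h3 : HasDerivAt (fun x : ℝ ↦ 1 - x * u) (-u) x := by
      simpa using ((hasDerivAt_id x).mul_const u).const_sub 1
    have h4 := (h3.rpow_const (p := b) (Or.inl (by linarith))).const_mul (u ^ p * (1 - u) ^ q)
    convert! h4 using 1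
    rw [Real.rpow_add_one hu.1.ne']
    ring

/-- The integral over `[0, 1]` of the derivative of `u^p (1-u)^q (1-ru)^b` vanishes. -/
theorem integral_deriv_euler {p q : ℝ} (hp : 0 < p) (hq : 0 < q) (b : ℝ) {r : ℝ} (hr : |r| < 1) :
    p * eulerIntegral (p - 1) q b r - q * eulerIntegral p (q - 1) b r
      - b * r * eulerIntegral p q (b - 1) r = 0 := by
  have i1 := intervalIntegrable_euler (p := p - 1) (q := q) (by linarith) (by linarith) b hr
  have i2 := intervalIntegrable_euler (p := p) (q := q - 1) (by linarith) (by linarith) b hr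
  have i3 := intervalIntegrable_euler (p := p) (q := q) (by linarith) (by linarith) (b - 1) hr
  have hpos : ∀ u ∈ Set.Icc (0 : ℝ) 1, 0 < 1 - r * u := fun u hu ↦ by
    have := (one_sub_mul_mem le_rfl hr hu.1 hu.2).1
    linarith
  have ftc := intervalIntegral.integral_eq_sub_of_hasDerivAt_of_le (a := 0) (b := 1) zero_le_one
    (f := fun u ↦ u ^ p * (1 - u) ^ q * (1 - r * u) ^ b)
    (f' := fun u ↦ p * (u ^ (p - 1) * (1 - u) ^ q * (1 - r * u) ^ b)
      - q * (u ^ p * (1 - u) ^ (q - 1) * (1 - r * u) ^ b)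
      - b * r * (u ^ p * (1 - u) ^ q * (1 - r * u) ^ (b - 1))) ?_ ?_
    (((i1.const_mul _).sub (i2.const_mul _)).sub (i3.const_mul _))
  · rw [intervalIntegral.integral_sub ((i1.const_mul _).sub (i2.const_mul _)) (i3.const_mul _),
      intervalIntegral.integral_sub (i1.const_mul _) (i2.const_mul _),
      intervalIntegral.integral_const_mul, intervalIntegral.integral_const_mul,
      intervalIntegral.integral_const_mul] at ftc
    simp only [eulerIntegral]
    rw [ftc, Real.zero_rpow hp.ne', sub_self, Real.zero_rpow hq.ne']
    simp
  · refine ((continuousOn_id.rpow_const fun _ _ ↦ Or.inr hp.le).mul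
      ((continuousOn_const.sub continuousOn_id).rpow_const fun _ _ ↦ Or.inr hq.le)).mul
      ((continuousOn_const.sub (continuousOn_const.mul continuousOn_id)).rpow_const
        fun u hu ↦ Or.inl (hpos u hu).ne')
  · intro u hu
    have h1 : HasDerivAt (fun u : ℝ ↦ u ^ p) (p * u ^ (p - 1)) u :=
      Real.hasDerivAt_rpow_const (Or.inl hu.1.ne')
    have h2 : HasDerivAt (fun u : ℝ ↦ (1 - u) ^ q) (-1 * q * (1 - u) ^ (q - 1)) u :=
      ((hasDerivAt_id u).const_sub 1).rpow_const (Or.inl (by simp only [id]; linarith [hu.2]))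
    have h3 : HasDerivAt (fun u : ℝ ↦ (1 - r * u) ^ b) (-(r * 1) * b * (1 - r * u) ^ (b - 1)) u :=
      (((hasDerivAt_id u).const_mul r).const_sub 1).rpow_const
        (Or.inl (hpos u ⟨hu.1.le, hu.2.le⟩).ne')
    convert! (h1.mul h2).mul h3 using 1
    simp only [Pi.mul_apply]
    ring

/-- Contiguity relation: together with `eulerIntegral_sub` it trades a factor `1 - r u` or `1 - u`
for a shift of the exponent of `u`. Relations between Euler integrals thereby become linear algebra
in integrals with common last two exponents. The shifted exponents enter through equations, so that
they may be written in any arithmetic form. -/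
theorem eulerIntegral_sub_mul {p p' q b b' : ℝ} (hp' : p' = p + 1) (hb' : b' = b + 1)
    (hp : -1 < p) (hq : -1 < q) {r : ℝ} (hr : |r| < 1) :
    eulerIntegral p q b' r = eulerIntegral p q b r - r * eulerIntegral p' q b r := by
  subst hp' hb'
  rw [eulerIntegral, eulerIntegral, eulerIntegral, ← intervalIntegral.integral_const_mul,
    ← intervalIntegral.integral_sub (intervalIntegrable_euler hp hq b hr)
      ((intervalIntegrable_euler (by linarith) hq b hr).const_mul _),
    intervalIntegral.integral_of_le zero_le_one, intervalIntegral.integral_of_le zero_le_one]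
  refine setIntegral_congr_fun measurableSet_Ioc fun u hu ↦ ?_
  have h := (one_sub_mul_mem le_rfl hr hu.1.le hu.2).1
  simp only [Real.rpow_add_one hu.1.ne', Real.rpow_add_one (x := 1 - r * u) (by linarith)]
  ring

theorem eulerIntegral_sub {p p' q q' : ℝ} (hp' : p' = p + 1) (hq' : q' = q + 1)
    (hp : -1 < p) (hq : -1 < q) (b : ℝ) {r : ℝ} (hr : |r| < 1) :
    eulerIntegral p q' b r = eulerIntegral p q b r - eulerIntegral p' q b r := by
  subst hp' hq'
  rw [eulerIntegral, eulerIntegral, eulerIntegral,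
    ← intervalIntegral.integral_sub (intervalIntegrable_euler hp hq b hr)
      (intervalIntegrable_euler (by linarith) hq b hr),
    intervalIntegral.integral_of_le zero_le_one, intervalIntegral.integral_of_le zero_le_one,
    integral_Ioc_eq_integral_Ioo, integral_Ioc_eq_integral_Ioo]
  refine setIntegral_congr_fun measurableSet_Ioo fun u hu ↦ ?_
  simp only [Real.rpow_add_one hu.1.ne', Real.rpow_add_one (x := 1 - u) (by linarith [hu.2])]
  ring

/-! ### An affine identity for Euler integrals -/

section Affine

variable {a : ℝ}

/-- `∫_0^1 u^a (1-u)^{-2a} (1-ru)^{a-2} du = B(1+a, 1-2a) (1-r)^{-a-1}`. -/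
theorem eulerIntegral_sub_two (ha : -1 < a) (ha' : a < 1 / 2) {r : ℝ} (hr : |r| < 1) :
    eulerIntegral a (-2 * a) (a - 2) r * (1 - r) ^ (a + 1) = beta (1 + a) (1 - 2 * a) := by
  have hd : ∀ x ∈ Set.Ioo (-1 : ℝ) 1, HasDerivAt
      (fun x ↦ eulerIntegral a (-2 * a) (a - 2) x * (1 - x) ^ (a + 1)) 0 x := by
    intro x hx
    have hx1 : |x| < 1 := abs_lt.2 hx
    have hx2 : 0 < 1 - x := by linarith [hx.2]
    have h1 := hasDerivAt_eulerIntegral ha (q := -2 * a) (by linarith) (a - 2) hx1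
    have h2 : HasDerivAt (fun x : ℝ ↦ (1 - x) ^ (a + 1)) (-1 * (a + 1) * (1 - x) ^ (a + 1 - 1)) x :=
      ((hasDerivAt_id x).const_sub 1).rpow_const (Or.inl hx2.ne')
    -- After the contiguity relations, this identity involves only the integrals with exponents `a`,
    -- `a + 1`, `a + 2` of `u`, with `-2a` and `a - 3` fixed. The derivative of the product is then
    -- a multiple of it.
    have h3 := integral_deriv_euler (p := a + 1) (q := 1 - 2 * a) (by linarith) (by linarith)
      (a - 2) hx1
    rw [show a + 1 - 1 = a by ring, show 1 - 2 * a - 1 = -2 * a by ring] at h3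
    rw [eulerIntegral_sub (p := a) (p' := a + 1) (q := -2 * a) (q' := 1 - 2 * a) rfl (by ring) ha (by linarith) _ hx1,
      eulerIntegral_sub (p := a + 1) (p' := a + 2) (q := -2 * a) (q' := 1 - 2 * a) (by ring) (by ring) (by linarith)
        (by linarith) _ hx1,
      eulerIntegral_sub_mul (p := a) (p' := a + 1) (b := a - 2 - 1) (b' := a - 2) (by ring) (by ring)
        (by linarith) (by linarith) hx1,
      eulerIntegral_sub_mul (p := a + 1) (p' := a + 2) (b := a - 2 - 1) (b' := a - 2) (by ring) (by ring)
        (by linarith) (by linarith) hx1] at h3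
    convert! h1.mul h2 using 1
    rw [eulerIntegral_sub_mul (p := a) (p' := a + 1) (b := a - 2 - 1) (b' := a - 2) (by ring) (by ring)
      (by linarith) (by linarith) hx1, show a + 1 - 1 = a by ring, Real.rpow_add_one hx2.ne']
    linear_combination (1 - x) ^ a * h3
  have h0 : (0 : ℝ) ∈ Set.Ioo (-1 : ℝ) 1 := by norm_num
  have hc := isOpen_Ioo.is_const_of_deriv_eq_zero isPreconnected_Ioo
    (fun x hx ↦ (hd x hx).differentiableAt.differentiableWithinAt)
    (fun x hx ↦ (hd x hx).deriv) (abs_lt.1 hr) h0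
  rw [hc, eulerIntegral]
  simp only [zero_mul, sub_zero, Real.one_rpow, mul_one]
  rw [integral_rpow_mul_one_sub_rpow ha (by linarith)]
  congr 1 <;> ring

/-- The function `∫_0^r (s(1-s))^a (r-s)^{-2a} ds`, see `integral_weight_left`. -/
def eulerFun (a r : ℝ) : ℝ := r ^ (1 - a) * eulerIntegral a (-2 * a) a r

/-- What matters is that the right side is invariant under `r ↦ 1 - r`. Subtracting the equations at
`r` and `1 - r` gives `(1 - 2r) G' + 2 G = 0` for `G(r) = eulerFun a (1 - r) - eulerFun a r`, whose
solutions away from `1/2` are multiples of `1 - 2r`. The equation follows by reducing every integral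
to last exponent `a - 2`, where `eulerIntegral_sub_two` gives a closed form. -/
theorem hasDerivAt_eulerFun (ha : -1 < a) (ha' : a < 1 / 2) {r : ℝ} (h0 : 0 < r) (h1 : r < 1) :
    ∃ d, HasDerivAt (eulerFun a) d r ∧ (1 - 2 * r) * d + 2 * eulerFun a r
      = (1 - a) * beta (1 + a) (1 - 2 * a) * (r * (1 - r)) ^ (-a) := by
  have hr : |r| < 1 := abs_lt.2 ⟨by linarith, h1⟩
  have hr' : 0 < 1 - r := by linarith
  refine ⟨_, (Real.hasDerivAt_rpow_const (Or.inl h0.ne')).mul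
    (hasDerivAt_eulerIntegral ha (q := -2 * a) (by linarith) a hr), ?_⟩
  have h2 : eulerIntegral a (-2 * a) (a - 2) r * (1 - r)
      = beta (1 + a) (1 - 2 * a) * (1 - r) ^ (-a) := by
    rw [← eulerIntegral_sub_two ha ha' hr, Real.rpow_add_one hr'.ne', Real.rpow_neg hr'.le]
    field_simp
  have h3 := integral_deriv_euler (p := a + 1) (q := 1 - 2 * a) (by linarith) (by linarith)
    (a - 1) hr
  rw [show a + 1 - 1 = a by ring, show 1 - 2 * a - 1 = -2 * a by ring,
    eulerIntegral_sub (p := a) (p' := a + 1) (q := -2 * a) (q' := 1 - 2 * a) rfl (by ring) ha (by linarith) _ hr,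
    eulerIntegral_sub (p := a + 1) (p' := a + 2) (q := -2 * a) (q' := 1 - 2 * a) (by ring) (by ring) (by linarith)
        (by linarith) _ hr,
    eulerIntegral_sub_mul (p := a) (p' := a + 1) (b := a - 2) (b' := a - 1) (by ring) (by ring)
        (by linarith) (by linarith) hr,
    eulerIntegral_sub_mul (p := a + 1) (p' := a + 2) (b := a - 2) (b' := a - 1) (by ring) (by ring)
        (by linarith) (by linarith) hr, show a - 1 - 1 = a - 2 by ring] at h3
  rw [eulerFun, Real.mul_rpow h0.le hr'.le,
    eulerIntegral_sub_mul (p := a) (p' := a + 1) (b := a - 1) (by ring) (by ring)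
        (by linarith) (by linarith) hr,
    eulerIntegral_sub_mul (p := a) (p' := a + 1) (b := a - 2) (b' := a - 1) (by ring) (by ring)
        (by linarith) (by linarith) hr,
    eulerIntegral_sub_mul (p := a + 1) (p' := a + 2) (b := a - 2) (b' := a - 1) (by ring) (by ring)
        (by linarith) (by linarith) hr,
    show 1 - a - 1 = -a by ring, show 1 - a = -a + 1 by ring, Real.rpow_add_one h0.ne']
  linear_combination r * r ^ (-a) * h3 + (1 - a) * r ^ (-a) * h2

/-- The case that needs care is `r = 1`, where `1 - r u` vanishes at `u = 1`. Since `1 - u ≤ 1 - r u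
≤ 1`, the last factor is at most `(1 - u)^a + 1` for either sign of `a`, and this leaves two
convergent beta integrands. -/
theorem continuousOn_eulerFun (ha : -1 < a) (ha' : a < 1 / 2) :
    ContinuousOn (eulerFun a) (Set.Icc 0 1) := by
  refine (continuousOn_id.rpow_const fun _ _ ↦ Or.inr (by linarith)).mul ?_
  have hE : eulerIntegral a (-2 * a) a = fun r ↦ ∫ u in Set.Ioo (0 : ℝ) 1,
      u ^ a * (1 - u) ^ (-2 * a) * (1 - r * u) ^ a := by
    ext r
    rw [eulerIntegral, intervalIntegral.integral_of_le zero_le_one, integral_Ioc_eq_integral_Ioo]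
  rw [hE]
  have i1 := intervalIntegrable_rpow_mul_one_sub_rpow (p := a) (q := -2 * a) ha (by linarith)
  have i2 := intervalIntegrable_rpow_mul_one_sub_rpow (p := a) (q := -a) ha (by linarith)
  rw [intervalIntegrable_iff_integrableOn_Ioo_of_le zero_le_one] at i1 i2
  refine continuousOn_of_dominated (bound := fun u ↦ u ^ a * (1 - u) ^ (-a)
      + u ^ a * (1 - u) ^ (-2 * a)) (fun r _ ↦ aestronglyMeasurable_euler _ _ _ _ _) ?_
    (i2.add i1) ?_
  · intro r hr
    rw [ae_restrict_iff' measurableSet_Ioo]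
    refine ae_of_all _ fun u hu ↦ ?_
    have hu1 : 0 < 1 - u := by linarith [hu.2]
    have h1 : 1 - u ≤ 1 - r * u := by nlinarith [hr.2, hu.1]
    have h2 : 1 - r * u ≤ 1 := by nlinarith [hr.1, hu.1]
    have h3 := rpow_le_rpow_add_rpow hu1 h1 h2 a
    rw [Real.one_rpow] at h3
    have h4 : 0 ≤ u ^ a := Real.rpow_nonneg hu.1.le _
    have h5 : 0 ≤ (1 - u) ^ (-2 * a) := Real.rpow_nonneg hu1.le _
    have h6 : 0 ≤ (1 - r * u) ^ a := Real.rpow_nonneg (by linarith) _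
    rw [Real.norm_of_nonneg (by positivity)]
    calc u ^ a * (1 - u) ^ (-2 * a) * (1 - r * u) ^ a
        ≤ u ^ a * (1 - u) ^ (-2 * a) * ((1 - u) ^ a + 1) := by gcongr
      _ = u ^ a * ((1 - u) ^ (-2 * a) * (1 - u) ^ a) + u ^ a * (1 - u) ^ (-2 * a) := by ring
      _ = _ := by rw [← Real.rpow_add hu1]; congr 3; ring
  · rw [ae_restrict_iff' measurableSet_Ioo]
    refine ae_of_all _ fun u hu ↦ continuousOn_const.mul
      ((continuousOn_const.sub (continuousOn_id.mul continuousOn_const)).rpow_const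
        fun r hr ↦ Or.inl ?_)
    have : r * u < 1 := by nlinarith [hr.2, hu.1, hu.2]
    exact (sub_pos.2 this).ne'

theorem eulerFun_zero (ha' : a < 1 / 2) : eulerFun a 0 = 0 := by
  rw [eulerFun, Real.zero_rpow (by linarith), zero_mul]

theorem eulerFun_one (ha : -1 < a) (ha' : a < 1 / 2) : eulerFun a 1 = beta (1 + a) (1 - a) := by
  rw [eulerFun, Real.one_rpow, one_mul, eulerIntegral, add_comm 1 a, sub_eq_neg_add,
    ← integral_rpow_mul_one_sub_rpow ha (by linarith),
    intervalIntegral.integral_of_le zero_le_one, intervalIntegral.integral_of_le zero_le_one,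
    integral_Ioc_eq_integral_Ioo, integral_Ioc_eq_integral_Ioo]
  refine setIntegral_congr_fun measurableSet_Ioo fun u hu ↦ ?_
  simp only [one_mul]
  rw [mul_assoc, ← Real.rpow_add (by linarith [hu.2])]
  congr 2; ring

/-- The function `eulerFun a (1 - r) - eulerFun a r` is affine on `[0, 1]`. -/
theorem eulerFun_one_sub_sub (ha : -1 < a) (ha' : a < 1 / 2) {r : ℝ} (hr : r ∈ Set.Icc (0 : ℝ) 1) :
    eulerFun a (1 - r) - eulerFun a r = beta (1 + a) (1 - a) * (1 - 2 * r) := by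
  -- Left of `1/2` the quotient by `1 - 2r` has derivative zero, so it equals its value at `0`. The
  -- right half follows because both sides change sign under `r ↦ 1 - r`, and at `1/2` both vanish.
  have main : ∀ r ∈ Set.Ico (0 : ℝ) (1 / 2),
      eulerFun a (1 - r) - eulerFun a r = beta (1 + a) (1 - a) * (1 - 2 * r) := by
    intro r hr
    have hP : ∀ x ∈ Set.Icc 0 r, 1 - 2 * x ≠ 0 := fun x hx ↦ by
      have := hx.2; have := hr.2; linarith
    have hsub : Set.Icc 0 r ⊆ Set.Icc (0 : ℝ) 1 := Set.Icc_subset_Icc_right (by linarith [hr.2])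
    have hcont : ContinuousOn (fun x ↦ (eulerFun a (1 - x) - eulerFun a x) / (1 - 2 * x))
        (Set.Icc 0 r) := by
      refine ContinuousOn.div ?_ (by fun_prop) hP
      refine ContinuousOn.sub ?_ ((continuousOn_eulerFun ha ha').mono hsub)
      refine (continuousOn_eulerFun ha ha').comp (by fun_prop) fun x hx ↦ ?_
      have := hsub hx
      exact ⟨by linarith [this.2], by linarith [this.1]⟩
    have hderiv : ∀ x ∈ Set.Ioo 0 r, HasDerivAt
        (fun x ↦ (eulerFun a (1 - x) - eulerFun a x) / (1 - 2 * x)) 0 x := by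
      intro x hx
      have hx1 : x < 1 / 2 := hx.2.trans hr.2
      obtain ⟨d, hd, e⟩ := hasDerivAt_eulerFun ha ha' hx.1 (by linarith)
      obtain ⟨d', hd', e'⟩ := hasDerivAt_eulerFun ha ha' (r := 1 - x) (by linarith)
        (by linarith [hx.1])
      have h1 : HasDerivAt (fun x ↦ eulerFun a (1 - x)) (-d') x := by
        have := hd'.comp x ((hasDerivAt_id x).const_sub 1)
        simpa [Function.comp_def] using this
      have h2 : HasDerivAt (fun x : ℝ ↦ 1 - 2 * x) (-2) x := by
        simpa using ((hasDerivAt_id x).const_mul 2).const_sub 1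
      convert! (h1.sub hd).div h2 (hP x ⟨hx.1.le, hx.2.le⟩) using 1
      rw [eq_comm, div_eq_zero_iff]
      left
      rw [show (1 - x) * (1 - (1 - x)) = x * (1 - x) by ring] at e'
      simp only [Pi.sub_apply]
      linear_combination e' - e
    have hI := intervalIntegral.integral_eq_sub_of_hasDerivAt_of_le hr.1 hcont hderiv
      intervalIntegrable_const
    simp only [intervalIntegral.integral_zero, sub_zero, mul_zero, div_one, eulerFun_zero ha',
      eulerFun_one ha ha'] at hI
    have h3 := hP r ⟨hr.1, le_rfl⟩
    have h4 : (eulerFun a (1 - r) - eulerFun a r) / (1 - 2 * r) = beta (1 + a) (1 - a) := by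
      linarith
    exact (div_eq_iff h3).1 h4
  rcases lt_trichotomy r (1 / 2) with h | h | h
  · exact main r ⟨hr.1, h⟩
  · rw [h]; norm_num
  · have := main (1 - r) ⟨by linarith [hr.2], by linarith⟩
    rw [sub_sub_cancel] at this
    linarith

end Affine

/-! ### The weighted singular kernel on the unit interval -/

section Kernel

variable {a : ℝ}

/-- The substitution `s = r u` produces the factor `r^{a - 2a + 1} = r^{1-a}` of `eulerFun`.
Integrability rests on the domination used for the continuity of `eulerFun`. -/
theorem intervalIntegrable_weight_left (ha : -1 < a) (ha' : a < 1 / 2) {r : ℝ}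
    (hr : r ∈ Set.Icc (0 : ℝ) 1) :
    IntervalIntegrable (fun s : ℝ ↦ (s * (1 - s)) ^ a * (r - s) ^ (-2 * a)) volume 0 r ∧
    ∫ s in (0 : ℝ)..r, (s * (1 - s)) ^ a * (r - s) ^ (-2 * a) = eulerFun a r := by
  rcases hr.1.eq_or_lt with rfl | h0
  · simp [eulerFun_zero ha']
  have hpt : ∀ u ∈ Set.Ioo (0 : ℝ) 1,
      (r * u * (1 - r * u)) ^ a * (r - r * u) ^ (-2 * a)
        = r ^ (-a) * (u ^ a * (1 - u) ^ (-2 * a) * (1 - r * u) ^ a) := by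
    intro u hu
    have h1 : 0 ≤ 1 - u := by linarith [hu.2]
    have h2 : 0 ≤ 1 - r * u := by nlinarith [hr.2, hu.1, hu.2]
    rw [show r - r * u = r * (1 - u) by ring, Real.mul_rpow (mul_nonneg h0.le hu.1.le) h2,
      Real.mul_rpow h0.le hu.1.le, Real.mul_rpow h0.le h1,
      show -a = a + -2 * a by ring, Real.rpow_add h0]
    ring
  have hint : IntervalIntegrable
      (fun u : ℝ ↦ (r * u * (1 - r * u)) ^ a * (r - r * u) ^ (-2 * a)) volume 0 1 := by
    have i1 := intervalIntegrable_rpow_mul_one_sub_rpow (p := a) (q := -2 * a) ha (by linarith)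
    have i2 := intervalIntegrable_rpow_mul_one_sub_rpow (p := a) (q := -a) ha (by linarith)
    have i3 := (i2.add i1).const_mul (r ^ (-a))
    rw [intervalIntegrable_iff_integrableOn_Ioo_of_le zero_le_one] at i3 ⊢
    refine Integrable.mono' i3 ?_ ?_
    · have : Measurable (fun u : ℝ ↦ (r * u * (1 - r * u)) ^ a * (r - r * u) ^ (-2 * a)) := by
        fun_prop
      exact this.aestronglyMeasurable
    rw [ae_restrict_iff' measurableSet_Ioo]
    refine ae_of_all _ fun u hu ↦ ?_
    have hu1 : 0 < 1 - u := by linarith [hu.2]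
    have h1 : 1 - u ≤ 1 - r * u := by nlinarith [hr.2, hu.1]
    have h2 : 1 - r * u ≤ 1 := by nlinarith [hr.1, hu.1]
    have h3 := rpow_le_rpow_add_rpow hu1 h1 h2 a
    rw [Real.one_rpow] at h3
    have h4 : 0 ≤ u ^ a := Real.rpow_nonneg hu.1.le _
    have h5 : 0 ≤ (1 - u) ^ (-2 * a) := Real.rpow_nonneg hu1.le _
    have h6 : 0 ≤ (1 - r * u) ^ a := Real.rpow_nonneg (by linarith) _
    have h7 : 0 ≤ r ^ (-a) := Real.rpow_nonneg h0.le _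
    rw [hpt u hu, Real.norm_of_nonneg (by positivity)]
    refine mul_le_mul_of_nonneg_left ?_ h7
    calc u ^ a * (1 - u) ^ (-2 * a) * (1 - r * u) ^ a
        ≤ u ^ a * (1 - u) ^ (-2 * a) * ((1 - u) ^ a + 1) := by gcongr
      _ = u ^ a * ((1 - u) ^ (-2 * a) * (1 - u) ^ a) + u ^ a * (1 - u) ^ (-2 * a) := by ring
      _ = _ := by rw [← Real.rpow_add hu1]; congr 3; ring
  constructor
  · have := hint.comp_mul_left (c := r⁻¹)
    simpa [mul_inv_cancel_left₀ h0.ne'] using this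
  · have h := intervalIntegral.mul_integral_comp_mul_left (a := 0) (b := 1) (c := r)
      (f := fun s : ℝ ↦ (s * (1 - s)) ^ a * (r - s) ^ (-2 * a))
    rw [mul_zero, mul_one] at h
    rw [← h, eulerFun, eulerIntegral, show 1 - a = -a + 1 by ring, Real.rpow_add_one h0.ne',
      mul_comm (r ^ (-a)) r, mul_assoc, ← intervalIntegral.integral_const_mul (r ^ (-a)),
      intervalIntegral.integral_of_le zero_le_one, intervalIntegral.integral_of_le zero_le_one,
      integral_Ioc_eq_integral_Ioo, integral_Ioc_eq_integral_Ioo]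
    exact congrArg _ (setIntegral_congr_fun measurableSet_Ioo hpt)

theorem intervalIntegrable_weight_right (ha : -1 < a) (ha' : a < 1 / 2) {r : ℝ}
    (hr : r ∈ Set.Icc (0 : ℝ) 1) :
    IntervalIntegrable (fun s : ℝ ↦ (s * (1 - s)) ^ a * (s - r) ^ (-2 * a)) volume r 1 ∧
    ∫ s in r..1, (s * (1 - s)) ^ a * (s - r) ^ (-2 * a) = eulerFun a (1 - r) := by
  obtain ⟨h1, h2⟩ := intervalIntegrable_weight_left ha ha' (r := 1 - r)
    ⟨by linarith [hr.2], by linarith [hr.1]⟩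
  have he : ∀ s : ℝ, ((1 - s) * (1 - (1 - s))) ^ a * (1 - r - (1 - s)) ^ (-2 * a)
      = (s * (1 - s)) ^ a * (s - r) ^ (-2 * a) := fun s ↦ by
    congr 2 <;> ring
  constructor
  · have := (h1.comp_sub_left 1).symm
    simp only [he, sub_zero] at this
    rwa [sub_sub_cancel] at this
  · rw [← h2]
    have := intervalIntegral.integral_comp_sub_left (a := r) (b := 1)
      (fun s : ℝ ↦ (s * (1 - s)) ^ a * (1 - r - s) ^ (-2 * a)) 1
    simpa only [he, sub_self] using this

/-- The derivative of `s ↦ |s - r|^{1-2a} / (1-2a)`. -/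
def signedPow (a x : ℝ) : ℝ := if 0 < x then x ^ (-2 * a) else -(-x) ^ (-2 * a)

/-- Splitting at `r` gives `-eulerFun a r` on the left and `eulerFun a (1 - r)` on the right, so
this is the affine identity again. It says that the weight `(s(1-s))^a` solves the integral equation
of the fundamental martingale. -/
theorem integral_weight_mul_signedPow (ha : -1 < a) (ha' : a < 1 / 2) {r : ℝ}
    (hr : r ∈ Set.Icc (0 : ℝ) 1) :
    IntervalIntegrable (fun s : ℝ ↦ (s * (1 - s)) ^ a * signedPow a (s - r)) volume 0 1 ∧
    ∫ s in (0 : ℝ)..1, (s * (1 - s)) ^ a * signedPow a (s - r)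
      = beta (1 + a) (1 - a) * (1 - 2 * r) := by
  obtain ⟨h1, h2⟩ := intervalIntegrable_weight_left ha ha' hr
  obtain ⟨h3, h4⟩ := intervalIntegrable_weight_right ha ha' hr
  have e1 : Set.EqOn (fun s : ℝ ↦ -((s * (1 - s)) ^ a * (r - s) ^ (-2 * a)))
      (fun s : ℝ ↦ (s * (1 - s)) ^ a * signedPow a (s - r)) (Set.uIoc 0 r) := by
    intro s hs
    rw [Set.uIoc_of_le hr.1] at hs
    simp only
    rw [signedPow, if_neg (by linarith [hs.2]), neg_sub]
    ring
  have e2 : Set.EqOn (fun s : ℝ ↦ (s * (1 - s)) ^ a * (s - r) ^ (-2 * a))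
      (fun s : ℝ ↦ (s * (1 - s)) ^ a * signedPow a (s - r)) (Set.uIoc r 1) := by
    intro s hs
    rw [Set.uIoc_of_le hr.2] at hs
    simp only
    rw [signedPow, if_pos (by linarith [hs.1])]
  have i1 := h1.neg.congr e1
  have i2 := h3.congr e2
  refine ⟨i1.trans i2, ?_⟩
  rw [← intervalIntegral.integral_add_adjacent_intervals i1 i2,
    ← eulerFun_one_sub_sub ha ha' hr, ← h2, ← h4,
    intervalIntegral.integral_congr_ae (ae_of_all _ fun s hs ↦ (e1 hs).symm),
    intervalIntegral.integral_congr_ae (ae_of_all _ fun s hs ↦ (e2 hs).symm),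
    intervalIntegral.integral_neg]
  ring

end Kernel

/-! ### The fundamental vector of a fractional Brownian motion on the unit interval -/

/-- The covariance of fractional Brownian motion with Hurst index `h`. -/
def fbmCov (h s r : ℝ) : ℝ := (s ^ (2 * h) + r ^ (2 * h) - |s - r| ^ (2 * h)) / 2

theorem beta_comm (p q : ℝ) : beta p q = beta q p := by
  rw [beta, beta, mul_comm, add_comm]

theorem rpow_mul_one_sub {s : ℝ} (hs : s ∈ Set.Icc (0 : ℝ) 1) (c : ℝ) :
    (s * (1 - s)) ^ c = s ^ c * (1 - s) ^ c :=
  Real.mul_rpow hs.1 (by linarith [hs.2])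

theorem intervalIntegrable_mul_one_sub_rpow {c : ℝ} (hc : -1 < c) :
    IntervalIntegrable (fun s : ℝ ↦ (s * (1 - s)) ^ c) volume 0 1 := by
  refine (intervalIntegrable_rpow_mul_one_sub_rpow hc hc).congr fun s hs ↦ ?_
  rw [Set.uIoc_of_le zero_le_one] at hs
  exact (rpow_mul_one_sub ⟨hs.1.le, hs.2⟩ c).symm

theorem integral_mul_one_sub_rpow {c : ℝ} (hc : -1 < c) :
    ∫ s in (0 : ℝ)..1, (s * (1 - s)) ^ c = beta (c + 1) (c + 1) := by
  rw [← integral_rpow_mul_one_sub_rpow hc hc]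
  refine intervalIntegral.integral_congr fun s hs ↦ ?_
  rw [Set.uIcc_of_le zero_le_one] at hs
  exact rpow_mul_one_sub hs c

theorem hasDerivAt_fbmCov {h s r : ℝ} (hs : 0 < s) (hsr : s ≠ r) :
    HasDerivAt (fun s ↦ fbmCov h s r)
      (h * (s ^ (2 * h - 1) - signedPow (1 / 2 - h) (s - r))) s := by
  have h1 : HasDerivAt (fun s : ℝ ↦ s ^ (2 * h)) (2 * h * s ^ (2 * h - 1)) s :=
    Real.hasDerivAt_rpow_const (Or.inl hs.ne')
  have h2 : HasDerivAt (fun s : ℝ ↦ |s - r| ^ (2 * h))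
      (2 * h * signedPow (1 / 2 - h) (s - r)) s := by
    rcases hsr.lt_or_gt with hlt | hgt
    · have h3 : HasDerivAt (fun s : ℝ ↦ (r - s) ^ (2 * h)) (-1 * (2 * h) * (r - s) ^ (2 * h - 1)) s :=
        ((hasDerivAt_id s).const_sub r).rpow_const (Or.inl (by simp only [id]; linarith))
      refine (h3.congr_of_eventuallyEq ?_).congr_deriv ?_
      · filter_upwards [Iio_mem_nhds hlt] with x hx
        rw [abs_of_neg (by linarith [Set.mem_Iio.1 hx]), neg_sub]
      · rw [signedPow, if_neg (by linarith), neg_sub, show -2 * (1 / 2 - h) = 2 * h - 1 by ring]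
        ring
    · have h3 : HasDerivAt (fun s : ℝ ↦ (s - r) ^ (2 * h)) (1 * (2 * h) * (s - r) ^ (2 * h - 1)) s :=
        ((hasDerivAt_id s).sub_const r).rpow_const (Or.inl (by simp only [id]; linarith))
      refine (h3.congr_of_eventuallyEq ?_).congr_deriv ?_
      · filter_upwards [Ioi_mem_nhds hgt] with x hx
        rw [abs_of_pos (by linarith [Set.mem_Ioi.1 hx])]
      · rw [signedPow, if_pos (by linarith), show -2 * (1 / 2 - h) = 2 * h - 1 by ring]
        ring
  refine (((h1.add_const (r ^ (2 * h))).sub h2).div_const 2).congr_deriv ?_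
  ring

section Hilbert

variable {E : Type*} [NormedAddCommGroup E] [InnerProductSpace ℝ E]
  {X : ℝ → E} {h : ℝ}

theorem norm_sub_of_inner_eq_fbmCov (h0 : 0 < h)
    (hX : ∀ s ∈ Set.Icc (0 : ℝ) 1, ∀ r ∈ Set.Icc (0 : ℝ) 1, inner ℝ (X s) (X r) = fbmCov h s r)
    {s r : ℝ} (hs : s ∈ Set.Icc (0 : ℝ) 1) (hr : r ∈ Set.Icc (0 : ℝ) 1) :
    ‖X s - X r‖ = |s - r| ^ h := by
  have h1 : ‖X s - X r‖ ^ 2 = (|s - r| ^ h) ^ 2 := by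
    rw [norm_sub_sq_real, hX s hs r hr, ← real_inner_self_eq_norm_sq, ← real_inner_self_eq_norm_sq,
      hX s hs s hs, hX r hr r hr, ← Real.rpow_natCast (|s - r| ^ h) 2,
      ← Real.rpow_mul (abs_nonneg _)]
    simp only [fbmCov, sub_self, abs_zero, Real.zero_rpow (by positivity : 2 * h ≠ 0)]
    push_cast
    rw [mul_comm h 2]
    ring
  exact (sq_eq_sq₀ (norm_nonneg _) (Real.rpow_nonneg (abs_nonneg _) _)).1 h1

theorem norm_of_inner_eq_fbmCov (h0 : 0 < h)
    (hX : ∀ s ∈ Set.Icc (0 : ℝ) 1, ∀ r ∈ Set.Icc (0 : ℝ) 1, inner ℝ (X s) (X r) = fbmCov h s r)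
    {s : ℝ} (hs : s ∈ Set.Icc (0 : ℝ) 1) : ‖X s‖ = s ^ h := by
  have h1 : X 0 = 0 := by
    rw [← inner_self_eq_zero (𝕜 := ℝ), hX 0 (by simp) 0 (by simp), fbmCov]
    simp [Real.zero_rpow (by positivity : 2 * h ≠ 0)]
  have := norm_sub_of_inner_eq_fbmCov h0 hX hs (r := 0) (by simp)
  rwa [h1, sub_zero, sub_zero, abs_of_nonneg hs.1] at this

/-- The bridge is at most `2 s^h` by comparison with `X 0 = 0`, and at most `2 (1-s)^h` by
comparison with `X 1`. Whichever of `s` and `1 - s` is at least `1/2` has `h`-th power at least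
`1/2`, which accounts for the remaining factor 2. -/
theorem norm_bridge_le (h0 : 0 < h) (h1 : h < 1)
    (hX : ∀ s ∈ Set.Icc (0 : ℝ) 1, ∀ r ∈ Set.Icc (0 : ℝ) 1, inner ℝ (X s) (X r) = fbmCov h s r)
    {s : ℝ} (hs : s ∈ Set.Icc (0 : ℝ) 1) : ‖X s - s • X 1‖ ≤ 4 * (s * (1 - s)) ^ h := by
  have hs' : 1 - s ∈ Set.Icc (0 : ℝ) 1 := ⟨by linarith [hs.2], by linarith [hs.1]⟩
  have hone : ‖X 1‖ = 1 := by
    rw [norm_of_inner_eq_fbmCov h0 hX (by simp), Real.one_rpow]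
  have hle : ∀ x ∈ Set.Icc (0 : ℝ) 1, x ≤ x ^ h := fun x hx ↦
    Real.self_le_rpow_of_le_one hx.1 hx.2 h1.le
  have b1 : ‖X s - s • X 1‖ ≤ 2 * s ^ h := by
    calc ‖X s - s • X 1‖ ≤ ‖X s‖ + ‖s • X 1‖ := norm_sub_le _ _
      _ = s ^ h + s := by
        rw [norm_smul, hone, norm_of_inner_eq_fbmCov h0 hX hs, Real.norm_of_nonneg hs.1, mul_one]
      _ ≤ _ := by linarith [hle s hs]
  have b2 : ‖X s - s • X 1‖ ≤ 2 * (1 - s) ^ h := by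
    calc ‖X s - s • X 1‖ = ‖(X s - X 1) + (1 - s) • X 1‖ := by congr 1; module
      _ ≤ ‖X s - X 1‖ + ‖(1 - s) • X 1‖ := norm_add_le _ _
      _ = (1 - s) ^ h + (1 - s) := by
        rw [norm_smul, hone, norm_sub_of_inner_eq_fbmCov h0 hX hs (by simp),
          Real.norm_of_nonneg hs'.1, mul_one, abs_sub_comm, abs_of_nonneg hs'.1]
      _ ≤ _ := by linarith [hle _ hs']
  have half : ∀ x : ℝ, 1 / 2 ≤ x → 1 / 2 ≤ x ^ h := fun x hx ↦
    (hle (1 / 2) (by norm_num)).trans (Real.rpow_le_rpow (by norm_num) hx h0.le)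
  rw [rpow_mul_one_sub hs]
  have p1 : 0 ≤ s ^ h := Real.rpow_nonneg hs.1 _
  have p2 : 0 ≤ (1 - s) ^ h := Real.rpow_nonneg hs'.1 _
  rcases le_total s (1 / 2) with hh | hh
  · have := half (1 - s) (by linarith)
    nlinarith
  · have := half s hh
    nlinarith

theorem continuousOn_of_inner_eq_fbmCov (h0 : 0 < h)
    (hX : ∀ s ∈ Set.Icc (0 : ℝ) 1, ∀ r ∈ Set.Icc (0 : ℝ) 1, inner ℝ (X s) (X r) = fbmCov h s r) :
    ContinuousOn X (Set.Icc 0 1) := by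
  intro s hs
  rw [ContinuousWithinAt, tendsto_iff_norm_sub_tendsto_zero]
  have h1 : Tendsto (fun x : ℝ ↦ |x - s| ^ h) (𝓝[Set.Icc 0 1] s) (𝓝 0) := by
    have h2 : Continuous (fun x : ℝ ↦ |x - s| ^ h) :=
      (continuous_abs.comp (continuous_sub_right s)).rpow_const fun _ ↦ Or.inr h0.le
    have := h2.tendsto s
    simp only [sub_self, abs_zero, Real.zero_rpow h0.ne'] at this
    exact this.mono_left nhdsWithin_le_nhds
  refine h1.congr' ?_
  filter_upwards [self_mem_nhdsWithin] with x hx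
  exact (norm_sub_of_inner_eq_fbmCov h0 hX hx hs).symm

/-- The derivative of `(s (1 - s))^a`. -/
def weightDeriv (a s : ℝ) : ℝ := a * (s * (1 - s)) ^ (a - 1) * (1 - 2 * s)

theorem hasDerivAt_weight (a : ℝ) {s : ℝ} (hs : s ∈ Set.Ioo (0 : ℝ) 1) :
    HasDerivAt (fun s : ℝ ↦ (s * (1 - s)) ^ a) (weightDeriv a s) s := by
  have h1 : HasDerivAt (fun s : ℝ ↦ s * (1 - s)) (1 * (1 - s) + s * (-1)) s :=
    (hasDerivAt_id s).mul ((hasDerivAt_id s).const_sub 1)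
  refine (h1.rpow_const (Or.inl (mul_pos hs.1 (by linarith [hs.2])).ne')).congr_deriv ?_
  rw [weightDeriv]
  ring

theorem continuousOn_weightDeriv (a : ℝ) : ContinuousOn (weightDeriv a) (Set.Ioo 0 1) := by
  unfold weightDeriv
  refine (continuousOn_const.mul (ContinuousOn.rpow_const (by fun_prop) fun s hs ↦ Or.inl ?_)).mul
    (by fun_prop)
  exact (mul_pos hs.1 (by linarith [hs.2])).ne'

/-- The derivative of the weight is of order `(s(1-s))^{-1/2-h}` at the ends, too singular for `X`
itself in general. The bridge gains `(s(1-s))^h` at both ends and leaves the integrable order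
`-1/2`. -/
theorem integrableOn_weightDeriv_smul_bridge (h0 : 0 < h) (h1 : h < 1)
    (hX : ∀ s ∈ Set.Icc (0 : ℝ) 1, ∀ r ∈ Set.Icc (0 : ℝ) 1, inner ℝ (X s) (X r) = fbmCov h s r) :
    IntegrableOn (fun s ↦ weightDeriv (1 / 2 - h) s • (X s - s • X 1)) (Set.Ioo 0 1) := by
  have i1 := (intervalIntegrable_mul_one_sub_rpow (c := -1 / 2) (by norm_num)).const_mul
    (4 * |1 / 2 - h|)
  rw [intervalIntegrable_iff_integrableOn_Ioo_of_le zero_le_one] at i1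
  refine Integrable.mono' i1 ?_ ?_
  · refine ContinuousOn.aestronglyMeasurable ?_ measurableSet_Ioo
    exact (continuousOn_weightDeriv _).smul
      (((continuousOn_of_inner_eq_fbmCov h0 hX).mono Set.Ioo_subset_Icc_self).sub
        (continuousOn_id.smul continuousOn_const))
  · rw [ae_restrict_iff' measurableSet_Ioo]
    refine ae_of_all _ fun s hs ↦ ?_
    have hpos : 0 < s * (1 - s) := mul_pos hs.1 (by linarith [hs.2])
    have b := norm_bridge_le h0 h1 hX ⟨hs.1.le, hs.2.le⟩
    have b2 : |1 - 2 * s| ≤ 1 := abs_le.2 ⟨by linarith [hs.2], by linarith [hs.1]⟩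
    have e : (s * (1 - s)) ^ (-1 / 2 : ℝ) = (s * (1 - s)) ^ (1 / 2 - h - 1) * (s * (1 - s)) ^ h := by
      rw [← Real.rpow_add hpos]; congr 1; ring
    have p1 : 0 ≤ (s * (1 - s)) ^ (1 / 2 - h - 1) := Real.rpow_nonneg hpos.le _
    have p2 : 0 ≤ (s * (1 - s)) ^ h := Real.rpow_nonneg hpos.le _
    rw [norm_smul, weightDeriv, norm_mul, norm_mul, Real.norm_of_nonneg p1, e, Real.norm_eq_abs,
      Real.norm_eq_abs]
    calc |1 / 2 - h| * (s * (1 - s)) ^ (1 / 2 - h - 1) * |1 - 2 * s| * ‖X s - s • X 1‖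
        ≤ |1 / 2 - h| * (s * (1 - s)) ^ (1 / 2 - h - 1) * 1 * (4 * (s * (1 - s)) ^ h) := by gcongr
      _ = _ := by ring

/-- Integration by parts moves the derivative onto the covariance. The derivative of `fbmCov h s r`
in `s` consists of `h s^{2h-1}`, which gives a beta integral, and the signed kernel, which gives the
same beta integral times `1 - 2r`. The constants cancel and only a multiple of `r` is left, besides
the term from the linear part of the bridge. -/
theorem integral_weightDeriv_mul_bridge (h0 : 0 < h) (h1 : h < 1)
    (hX : ∀ s ∈ Set.Icc (0 : ℝ) 1, ∀ r ∈ Set.Icc (0 : ℝ) 1, inner ℝ (X s) (X r) = fbmCov h s r)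
    {r : ℝ} (hr : r ∈ Set.Icc (0 : ℝ) 1) :
    ∫ s in Set.Ioo (0 : ℝ) 1, weightDeriv (1 / 2 - h) s * (fbmCov h s r - s * fbmCov h 1 r)
      = beta (3 / 2 - h) (3 / 2 - h) * fbmCov h 1 r
        - 2 * h * beta (3 / 2 - h) (1 / 2 + h) * r := by
  set a := 1 / 2 - h with ha
  have hin : ∀ s ∈ Set.Icc (0 : ℝ) 1,
      fbmCov h s r - s * fbmCov h 1 r = inner ℝ (X s - s • X 1) (X r) := fun s hs ↦ by
    rw [inner_sub_left, real_inner_smul_left, hX s hs r hr, hX 1 (by simp) r hr]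
  have hbd : ∀ s ∈ Set.Icc (0 : ℝ) 1,
      |fbmCov h s r - s * fbmCov h 1 r| ≤ 4 * (s * (1 - s)) ^ h := fun s hs ↦ by
    rw [hin s hs]
    refine (abs_real_inner_le_norm _ _).trans ?_
    have b1 : ‖X r‖ ≤ 1 := by
      rw [norm_of_inner_eq_fbmCov h0 hX hr]
      exact Real.rpow_le_one hr.1 hr.2 h0.le
    calc _ ≤ ‖X s - s • X 1‖ * 1 := by gcongr
      _ ≤ _ := by rw [mul_one]; exact norm_bridge_le h0 h1 hX hs
  have i0 : IntervalIntegrable (fun s ↦ weightDeriv a s * (fbmCov h s r - s * fbmCov h 1 r))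
      volume 0 1 := by
    rw [intervalIntegrable_iff_integrableOn_Ioo_of_le zero_le_one]
    refine IntegrableOn.congr_fun
      ((integrableOn_weightDeriv_smul_bridge h0 h1 hX).inner_const (𝕜 := ℝ) (X r))
      (fun s hs ↦ ?_) measurableSet_Ioo
    rw [real_inner_smul_left, hin s ⟨hs.1.le, hs.2.le⟩]
  obtain ⟨i1, e1⟩ := integral_weight_mul_signedPow (a := a) (by linarith) (by linarith) hr
  have i2 : IntervalIntegrable (fun s : ℝ ↦ (s * (1 - s)) ^ a * s ^ (2 * h - 1)) volume 0 1 ∧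
      ∫ s in (0 : ℝ)..1, (s * (1 - s)) ^ a * s ^ (2 * h - 1) = beta (1 + a) (1 - a) := by
    have e : Set.EqOn (fun s : ℝ ↦ s ^ (-a) * (1 - s) ^ a)
        (fun s : ℝ ↦ (s * (1 - s)) ^ a * s ^ (2 * h - 1)) (Set.uIoc 0 1) := by
      intro s hs
      rw [Set.uIoc_of_le zero_le_one] at hs
      simp only
      rw [rpow_mul_one_sub ⟨hs.1.le, hs.2⟩, mul_right_comm, ← Real.rpow_add hs.1]
      congr 2
      rw [ha]; ring
    constructor
    · exact (intervalIntegrable_rpow_mul_one_sub_rpow (by linarith) (by linarith)).congr e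
    · rw [← intervalIntegral.integral_congr_ae (ae_of_all _ e),
        integral_rpow_mul_one_sub_rpow (by linarith) (by linarith), beta_comm]
      congr 1 <;> ring
  obtain ⟨i2, e2⟩ := i2
  have i3 := intervalIntegrable_mul_one_sub_rpow (c := a) (by linarith)
  have e3 := integral_mul_one_sub_rpow (c := a) (by linarith)
  have hcontR : Continuous fun s ↦ fbmCov h s r - s * fbmCov h 1 r := by
    unfold fbmCov
    have c1 : Continuous fun s : ℝ ↦ s ^ (2 * h) :=
      continuous_id.rpow_const fun _ ↦ Or.inr (by linarith)
    have c2 : Continuous fun s : ℝ ↦ |s - r| ^ (2 * h) :=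
      (continuous_abs.comp (continuous_sub_right r)).rpow_const fun _ ↦ Or.inr (by linarith)
    fun_prop
  -- The weight is unbounded at the ends when `h > 1/2`. This bound gives continuity up to the ends
  -- and vanishing boundary terms.
  have hbd' : ∀ s ∈ Set.Icc (0 : ℝ) 1,
      |(s * (1 - s)) ^ a * (fbmCov h s r - s * fbmCov h 1 r)| ≤ 4 * (s * (1 - s)) ^ (1 / 2 : ℝ) := by
    intro s hs
    have hpos : 0 ≤ s * (1 - s) := mul_nonneg hs.1 (by linarith [hs.2])
    have p1 : 0 ≤ (s * (1 - s)) ^ a := Real.rpow_nonneg hpos _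
    rw [abs_mul, abs_of_nonneg p1]
    calc _ ≤ (s * (1 - s)) ^ a * (4 * (s * (1 - s)) ^ h) := by gcongr; exact hbd s hs
      _ = 4 * ((s * (1 - s)) ^ a * (s * (1 - s)) ^ h) := by ring
      _ = _ := by
        rw [← Real.rpow_add' hpos (by rw [ha]; ring_nf; norm_num), show a + h = 1 / 2 by
          rw [ha]; ring]
  have z0 : (0 : ℝ) ^ a * (fbmCov h 0 r - 0 * fbmCov h 1 r) = 0 := by
    rw [fbmCov, Real.zero_rpow (by positivity : 2 * h ≠ 0), zero_sub, abs_neg, abs_of_nonneg hr.1]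
    ring
  have hcont : ContinuousOn (fun s ↦ (s * (1 - s)) ^ a * (fbmCov h s r - s * fbmCov h 1 r))
      (Set.Icc 0 1) := by
    have hzero : ∀ s ∈ Set.Icc (0 : ℝ) 1, s * (1 - s) = 0 →
        (s * (1 - s)) ^ a * (fbmCov h s r - s * fbmCov h 1 r) = 0 := by
      intro s hs h2
      have h3 := hbd' s hs
      rw [h2, Real.zero_rpow (by norm_num : (1 / 2 : ℝ) ≠ 0), mul_zero] at h3
      rw [h2]
      exact abs_nonpos_iff.1 h3
    intro s hs
    by_cases h2 : s * (1 - s) = 0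
    · rw [ContinuousWithinAt, hzero s hs h2]
      have h3 : Tendsto (fun s : ℝ ↦ 4 * (s * (1 - s)) ^ (1 / 2 : ℝ)) (𝓝[Set.Icc 0 1] s) (𝓝 0) := by
        have h4 : Continuous (fun s : ℝ ↦ 4 * (s * (1 - s)) ^ (1 / 2 : ℝ)) :=
          continuous_const.mul ((by fun_prop : Continuous fun s : ℝ ↦ s * (1 - s)).rpow_const
            fun _ ↦ Or.inr (by norm_num))
        have := h4.tendsto s
        rw [h2, Real.zero_rpow (by norm_num : (1 / 2 : ℝ) ≠ 0), mul_zero] at this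
        exact this.mono_left nhdsWithin_le_nhds
      refine squeeze_zero_norm' ?_ h3
      filter_upwards [self_mem_nhdsWithin] with x hx using hbd' x hx
    · exact ((((by fun_prop : Continuous fun s : ℝ ↦ s * (1 - s)).continuousAt).rpow_const
        (Or.inl h2)).mul hcontR.continuousAt).continuousWithinAt
  -- The point `s = r` is exempted: for `h ≤ 1/2` the term `|s - r|^{2h}` is not differentiable
  -- there.
  have ftc := integral_eq_of_hasDerivAt_off_countable_of_le
    (fun s ↦ (s * (1 - s)) ^ a * (fbmCov h s r - s * fbmCov h 1 r))
    (fun s ↦ weightDeriv a s * (fbmCov h s r - s * fbmCov h 1 r)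
      + (h * ((s * (1 - s)) ^ a * s ^ (2 * h - 1)) - h * ((s * (1 - s)) ^ a * signedPow a (s - r))
        - fbmCov h 1 r * (s * (1 - s)) ^ a)) zero_le_one (Set.countable_singleton r) hcont
    (fun s hs ↦ by
      have d1 := hasDerivAt_fbmCov (h := h) hs.1.1 hs.2
      have d2 := (hasDerivAt_weight a hs.1).mul (d1.sub ((hasDerivAt_id s).mul_const (fbmCov h 1 r)))
      convert! d2 using 1
      simp only [Pi.sub_apply, id]
      ring)
    (i0.add (((i2.const_mul h).sub (i1.const_mul h)).sub (i3.const_mul _)))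
  rw [intervalIntegral.integral_add i0 (((i2.const_mul h).sub (i1.const_mul h)).sub
      (i3.const_mul _)), intervalIntegral.integral_sub ((i2.const_mul h).sub (i1.const_mul h))
      (i3.const_mul _), intervalIntegral.integral_sub (i2.const_mul h) (i1.const_mul h),
    intervalIntegral.integral_const_mul, intervalIntegral.integral_const_mul,
    intervalIntegral.integral_const_mul, e1, e2, e3, sub_zero 1, zero_mul 1, z0, one_mul (fbmCov h 1 r),
    sub_self, mul_zero, sub_zero] at ftc
  rw [← integral_Ioc_eq_integral_Ioo, ← intervalIntegral.integral_of_le zero_le_one,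
    show 3 / 2 - h = a + 1 by rw [ha]; ring, show 1 / 2 + h = 1 - a by rw [ha]; ring,
    add_comm (1 : ℝ) a] at *
  linear_combination ftc

/-- In a Hilbert space spanned by a fractional Brownian motion on `[0, 1]`, the functional
`X r ↦ r` is represented by a vector of explicit norm. -/
theorem exists_fundamental_vector [CompleteSpace E] (h0 : 0 < h) (h1 : h < 1)
    (hX : ∀ s ∈ Set.Icc (0 : ℝ) 1, ∀ r ∈ Set.Icc (0 : ℝ) 1, inner ℝ (X s) (X r) = fbmCov h s r) :
    ∃ Y ∈ (Submodule.span ℝ (X '' Set.Icc 0 1)).topologicalClosure,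
      (∀ r ∈ Set.Icc (0 : ℝ) 1, inner ℝ Y (X r) = r) ∧
      inner ℝ Y Y = Real.Gamma (3 / 2 - h) /
        (2 * h * Real.Gamma (h + 1 / 2) * Real.Gamma (3 - 2 * h)) := by
  -- Formally `b • X 1 - I` is `∫ (s(1-s))^{1/2-h} dX_s`: here `b` is the integral of the weight and
  -- `-I` is the integral against the bridge after integration by parts. The number `κ` normalizes
  -- its pairing with `X r` to `r`.
  set b := beta (3 / 2 - h) (3 / 2 - h) with hb
  set κ := 2 * h * beta (3 / 2 - h) (1 / 2 + h) with hκ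
  have hκ0 : 0 < κ := mul_pos (by positivity) (beta_pos (by linarith) (by linarith))
  have hint := integrableOn_weightDeriv_smul_bridge h0 h1 hX
  set I := ∫ s in Set.Ioo (0 : ℝ) 1, weightDeriv (1 / 2 - h) s • (X s - s • X 1) with hI
  have hinner : ∀ v : E, inner ℝ I v
      = ∫ s in Set.Ioo (0 : ℝ) 1, weightDeriv (1 / 2 - h) s * inner ℝ (X s - s • X 1) v := by
    intro v
    rw [real_inner_comm, hI, ← integral_inner hint]
    refine integral_congr_ae (ae_of_all _ fun s ↦ ?_)
    change inner ℝ v (weightDeriv (1 / 2 - h) s • (X s - s • X 1)) = _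
    rw [real_inner_smul_right, real_inner_comm]
  have hIX : ∀ r ∈ Set.Icc (0 : ℝ) 1, inner ℝ I (X r) = b * fbmCov h 1 r - κ * r := by
    intro r hr
    rw [hinner, ← integral_weightDeriv_mul_bridge h0 h1 hX hr]
    refine setIntegral_congr_fun measurableSet_Ioo fun s hs ↦ ?_
    rw [inner_sub_left, real_inner_smul_left, hX s ⟨hs.1.le, hs.2.le⟩ r hr, hX 1 (by simp) r hr]
  have hYX : ∀ r ∈ Set.Icc (0 : ℝ) 1, inner ℝ (κ⁻¹ • (b • X 1 - I)) (X r) = r := by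
    intro r hr
    rw [real_inner_smul_left, inner_sub_left, real_inner_smul_left, hIX r hr, hX 1 (by simp) r hr]
    field_simp
    ring
  refine ⟨κ⁻¹ • (b • X 1 - I), ?_, hYX, ?_⟩
  -- The closure is the double orthogonal complement, and a vector orthogonal to all `X s` is
  -- orthogonal to the Bochner integral `I`.
  · rw [← Submodule.orthogonal_orthogonal_eq_closure]
    refine Submodule.smul_mem _ _ (Submodule.sub_mem _ (Submodule.smul_mem _ _ ?_) ?_)
    · exact Submodule.le_orthogonal_orthogonal _
        (Submodule.subset_span ⟨1, by simp, rfl⟩)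
    · rw [Submodule.mem_orthogonal']
      intro v hv
      rw [hinner]
      refine setIntegral_eq_zero_of_forall_eq_zero fun s hs ↦ ?_
      rw [Submodule.mem_orthogonal] at hv
      rw [inner_sub_left, real_inner_smul_left,
        hv _ (Submodule.subset_span ⟨s, ⟨hs.1.le, hs.2.le⟩, rfl⟩),
        hv _ (Submodule.subset_span ⟨1, by simp, rfl⟩)]
      ring
  · set Y := κ⁻¹ • (b • X 1 - I) with hY
    -- The vector `Y` pairs with the bridge to `s - s · 1 = 0`. Hence only `b • X 1` contributes to
    -- the norm of `Y`, which is `b / κ` without any double integral.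
    have hIY : inner ℝ I Y = 0 := by
      rw [hinner]
      refine setIntegral_eq_zero_of_forall_eq_zero fun s hs ↦ ?_
      rw [inner_sub_left, real_inner_smul_left, real_inner_comm, hYX s ⟨hs.1.le, hs.2.le⟩,
        real_inner_comm, hYX 1 (by simp)]
      ring
    have hYY : inner ℝ Y Y = κ⁻¹ * b := by
      conv_lhs => rw [hY, real_inner_smul_left, inner_sub_left, real_inner_smul_left, ← hY]
      rw [hIY, real_inner_comm, hYX 1 (by simp)]
      ring
    have g1 : Real.Gamma (3 / 2 - h) ≠ 0 := (Real.Gamma_pos_of_pos (by linarith)).ne'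
    have g2 : Real.Gamma (h + 1 / 2) ≠ 0 := (Real.Gamma_pos_of_pos (by linarith)).ne'
    have g3 : Real.Gamma (3 - 2 * h) ≠ 0 := (Real.Gamma_pos_of_pos (by linarith)).ne'
    rw [hYY, hκ, hb, beta, beta, show 3 / 2 - h + (1 / 2 + h) = 1 + 1 by ring,
      show 3 / 2 - h + (3 / 2 - h) = 3 - 2 * h by ring, Real.Gamma_add_one one_ne_zero,
      Real.Gamma_one, add_comm (1 / 2) h]
    field_simp

end Hilbert

variable {Ω : Type*} [MeasurableSpace Ω]

/-! ### Gaussian Hilbert spaces -/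

section GaussianHilbert

variable {P : Measure Ω}

theorem inner_eq_integral_of_ae_eq {f g : Lp ℝ 2 P} {F G : Ω → ℝ} (hf : f =ᵐ[P] F)
    (hg : g =ᵐ[P] G) : inner ℝ f g = ∫ ω, F ω * G ω ∂P := by
  rw [L2.inner_def]
  refine integral_congr_ae ?_
  filter_upwards [hf, hg] with ω h1 h2
  rw [h1, h2, real_inner_eq_re_inner, RCLike.inner_apply]
  simp [mul_comm]

theorem coeFn_sum_smul {T : Type*} (I : Finset T) (c : T → ℝ) {x : T → Lp ℝ 2 P}
    {X : T → Ω → ℝ} (hx : ∀ t, x t =ᵐ[P] X t) :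
    (∑ t ∈ I, c t • x t : Lp ℝ 2 P) =ᵐ[P] fun ω ↦ ∑ t ∈ I, c t * X t ω := by
  classical
  induction I using Finset.induction_on with
  | empty => simp only [Finset.sum_empty]; exact Lp.coeFn_zero ℝ 2 P
  | insert i I hi ih =>
    rw [Finset.sum_insert hi]
    filter_upwards [Lp.coeFn_add (c i • x i) (∑ t ∈ I, c t • x t), Lp.coeFn_smul (c i) (x i), ih,
      hx i] with ω h1 h2 h3 h4
    rw [h1, Pi.add_apply, h2, h3, Pi.smul_apply, h4, Finset.sum_insert hi, smul_eq_mul]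

/-- The characteristic function of `f` is that of the centered Gaussian law with variance
`‖f‖²`. -/
def IsCenteredGaussian (f : Lp ℝ 2 P) : Prop :=
  ∀ ξ : ℝ, ∫ ω, Complex.exp (ξ * f ω * Complex.I) ∂P = Complex.exp (-(ξ ^ 2 * ‖f‖ ^ 2 / 2 : ℝ))

theorem IsCenteredGaussian.map_eq [IsProbabilityMeasure P] {f : Lp ℝ 2 P}
    (hf : IsCenteredGaussian f) : P.map f = gaussianReal 0 (‖f‖₊ ^ 2) := by
  have hm : AEMeasurable f P := (Lp.aestronglyMeasurable f).aemeasurable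
  have : IsProbabilityMeasure (P.map f) := Measure.isProbabilityMeasure_map hm
  refine Measure.ext_of_charFun ?_
  ext ξ
  rw [charFun_apply_real, charFun_gaussianReal, integral_map hm (by fun_prop), hf ξ]
  congr 1
  push_cast
  simp
  ring

theorem IsCenteredGaussian.integral_eq_zero [IsProbabilityMeasure P] {f : Lp ℝ 2 P}
    (hf : IsCenteredGaussian f) : ∫ ω, f ω ∂P = 0 := by
  have hm : AEMeasurable f P := (Lp.aestronglyMeasurable f).aemeasurable
  have h : ∫ x, x ∂(P.map f) = ∫ ω, f ω ∂P := integral_map hm (by fun_prop)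
  rw [← h, hf.map_eq, integral_id_gaussianReal]

theorem isCenteredGaussian_of_hasGaussianLaw [IsProbabilityMeasure P] {f : Lp ℝ 2 P}
    (hf : HasGaussianLaw f P) (h0 : ∫ ω, f ω ∂P = 0) : IsCenteredGaussian f := by
  intro ξ
  have hm : AEMeasurable f P := (Lp.aestronglyMeasurable f).aemeasurable
  have h1 : ∫ ω, Complex.exp (ξ * f ω * Complex.I) ∂P = charFun (P.map f) ξ := by
    rw [charFun_apply_real, integral_map hm (by fun_prop)]
  have h2 : Var[f; P] = ‖f‖ ^ 2 := by
    rw [variance_of_integral_eq_zero hm h0, ← real_inner_self_eq_norm_sq,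
      inner_eq_integral_of_ae_eq (ae_eq_refl f) (ae_eq_refl f)]
    simp [pow_two]
  rw [h1, hf.map_eq_gaussianReal, charFun_gaussianReal, h0, h2, Real.coe_toNNReal _ (sq_nonneg _)]
  congr 1
  push_cast
  simp
  ring

theorem norm_exp_mul_I_sub_le (x y : ℝ) :
    ‖Complex.exp (x * Complex.I) - Complex.exp (y * Complex.I)‖ ≤ |x - y| := by
  have h : Complex.exp (x * Complex.I) - Complex.exp (y * Complex.I)
      = Complex.exp (Complex.I * y) * (Complex.exp (Complex.I * (x - y : ℝ)) - 1) := by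
    rw [mul_sub, ← Complex.exp_add, mul_one]
    congr 2 <;> push_cast <;> ring
  rw [h, norm_mul, Complex.norm_exp_I_mul_ofReal, one_mul]
  exact Real.norm_exp_I_mul_ofReal_sub_one_le

theorem integrable_exp_mul_I [IsProbabilityMeasure P] (f : Lp ℝ 2 P) (ξ : ℝ) :
    Integrable (fun ω ↦ Complex.exp (ξ * f ω * Complex.I)) P := by
  have hm : AEMeasurable f P := (Lp.aestronglyMeasurable f).aemeasurable
  refine Integrable.of_bound (C := 1) (AEMeasurable.aestronglyMeasurable (by fun_prop))
    (ae_of_all _ fun ω ↦ ?_)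
  rw [← Complex.ofReal_mul, mul_comm, Complex.norm_exp_I_mul_ofReal]

theorem integral_norm_le_norm [IsProbabilityMeasure P] (f : Lp ℝ 2 P) :
    ∫ ω, |f ω| ∂P ≤ ‖f‖ := by
  have h1 : eLpNorm f 1 P ≤ eLpNorm f 2 P :=
    eLpNorm_le_eLpNorm_of_exponent_le (by norm_num) (Lp.aestronglyMeasurable f)
  have h2 : ∫ ω, |f ω| ∂P = (eLpNorm f 1 P).toReal := by
    rw [eLpNorm_one_eq_lintegral_enorm, integral_eq_lintegral_of_nonneg_ae
      (ae_of_all _ fun _ ↦ abs_nonneg _) (Lp.aestronglyMeasurable f).norm]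
    simp only [← Real.norm_eq_abs, ofReal_norm]
  rw [h2, Lp.norm_def]
  exact ENNReal.toReal_mono (Lp.eLpNorm_ne_top f) h1

/-- For fixed `ξ`, the characteristic function is Lipschitz in `f` with constant `|ξ|`, because `x ↦
exp(ixξ)` is and the `L¹` norm is at most the `L²` norm. The condition therefore equates two
continuous functions of `f`. -/
theorem isClosed_isCenteredGaussian [IsProbabilityMeasure P] :
    IsClosed {f : Lp ℝ 2 P | IsCenteredGaussian f} := by
  simp only [IsCenteredGaussian, Set.ofPred_forall]
  refine isClosed_iInter fun ξ ↦ isClosed_eq ?_ (by fun_prop)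
  refine (LipschitzWith.of_dist_le_mul (K := ⟨|ξ|, abs_nonneg ξ⟩) fun f g ↦ ?_).continuous
  have hi : Integrable (fun ω ↦ |ξ| * |(f - g : Lp ℝ 2 P) ω|) P :=
    (((Lp.memLp (f - g)).integrable one_le_two).abs).const_mul _
  rw [dist_eq_norm, dist_eq_norm, ← integral_sub (integrable_exp_mul_I f ξ)
    (integrable_exp_mul_I g ξ)]
  calc _ ≤ ∫ ω, |ξ| * |(f - g : Lp ℝ 2 P) ω| ∂P := by
        refine norm_integral_le_of_norm_le hi ?_
        filter_upwards [Lp.coeFn_sub f g] with ω h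
        rw [h, Pi.sub_apply, ← abs_mul, mul_sub, ← Complex.ofReal_mul, ← Complex.ofReal_mul]
        exact norm_exp_mul_I_sub_le _ _
    _ ≤ _ := by
        rw [integral_const_mul]
        exact mul_le_mul_of_nonneg_left (integral_norm_le_norm _) (abs_nonneg _)

variable {T : Type*}

theorem isCenteredGaussian_of_mem_closure_span [IsProbabilityMeasure P] {X : T → Ω → ℝ}
    (hX : IsGaussianProcess X P) (h0 : ∀ t, ∫ ω, X t ω ∂P = 0) {x : T → Lp ℝ 2 P}
    (hx : ∀ t, x t =ᵐ[P] X t) {f : Lp ℝ 2 P}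
    (hf : f ∈ (Submodule.span ℝ (Set.range x)).topologicalClosure) : IsCenteredGaussian f := by
  refine closure_minimal (fun g hg ↦ ?_) isClosed_isCenteredGaussian hf
  obtain ⟨c, rfl⟩ := Finsupp.mem_span_range_iff_exists_finsupp.1 hg
  have hc : (c.sum fun t a ↦ a • x t : Lp ℝ 2 P) =ᵐ[P] fun ω ↦ ∑ t ∈ c.support, c t * X t ω :=
    coeFn_sum_smul c.support c hx
  refine isCenteredGaussian_of_hasGaussianLaw ?_ ?_
  · exact (hX.smul c).hasGaussianLaw_fun_sum.congr hc.symm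
  · rw [integral_congr_ae hc, integral_finsetSum _ fun t _ ↦
      (hX.hasGaussianLaw_eval t).integrable.const_mul _]
    simp [integral_const_mul, h0]

/-- A family in a linear space of centered Gaussian variables is a Gaussian process. -/
theorem isGaussianProcess_of_mem [IsProbabilityMeasure P] {S : Submodule ℝ (Lp ℝ 2 P)}
    (hS : ∀ f ∈ S, IsCenteredGaussian f) {X : T → Ω → ℝ}
    (hX : ∀ t, ∃ f ∈ S, f =ᵐ[P] X t) : IsGaussianProcess X P := by
  choose x hxS hx using hX
  have hm : ∀ t, AEMeasurable (X t) P := fun t ↦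
    (Lp.aestronglyMeasurable (x t)).aemeasurable.congr (hx t)
  refine ⟨fun I ↦ ⟨⟨fun L ↦ ?_⟩⟩⟩
  have hmI : AEMeasurable (fun ω ↦ I.restrict (X · ω)) P :=
    aemeasurable_pi_lambda _ fun i ↦ hm i
  classical
  -- A functional `L` of a finite marginal is the combination of the coordinates with coefficients
  -- `L(e_i)`. It is thus represented in `S` and has a centered Gaussian law.
  set g : Lp ℝ 2 P := ∑ i : I, L (Pi.single i 1) • x i with hg
  have hgS : IsCenteredGaussian g :=
    hS _ (Submodule.sum_mem _ fun i _ ↦ Submodule.smul_mem _ _ (hxS _))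
  have hgL : g =ᵐ[P] fun ω ↦ L (I.restrict (X · ω)) := by
    filter_upwards [coeFn_sum_smul (P := P) Finset.univ (fun i : I ↦ L (Pi.single i 1))
      (fun i : I ↦ hx i)] with ω h
    rw [hg, h]
    conv_rhs => rw [← Finset.univ_sum_single (I.restrict (X · ω)), map_sum]
    refine Finset.sum_congr rfl fun i _ ↦ ?_
    have : (Pi.single i (I.restrict (X · ω) i) : I → ℝ)
        = (X i ω) • (Pi.single i (1 : ℝ) : I → ℝ) := by
      rw [← Pi.single_smul, smul_eq_mul, mul_one]; rfl
    rw [this, map_smul, smul_eq_mul, mul_comm]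
  have h1 : (P.map (fun ω ↦ I.restrict (X · ω))).map L = gaussianReal 0 (‖g‖₊ ^ 2) := by
    rw [AEMeasurable.map_map_of_aemeasurable (by fun_prop) hmI, ← hgS.map_eq]
    exact Measure.map_congr hgL.symm
  have h2 : ∫ x, L x ∂(P.map (fun ω ↦ I.restrict (X · ω))) = 0 := by
    have := integral_id_gaussianReal (μ := 0) (v := ‖g‖₊ ^ 2)
    rw [← h1, integral_map (by fun_prop) (by fun_prop)] at this
    exact this
  have h3 : Var[L; P.map (fun ω ↦ I.restrict (X · ω))] = ‖g‖₊ ^ 2 := by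
    have := variance_id_gaussianReal (μ := 0) (v := ‖g‖₊ ^ 2)
    rw [← h1, variance_map (by fun_prop) (by fun_prop)] at this
    exact_mod_cast this
  rw [h1, h2, h3]
  congr 1
  rw [← NNReal.coe_pow, Real.toNNReal_coe]

end GaussianHilbert

/-! ### The projected martingale of the fractional Gaussian field -/

section Field

variable {P : Measure Ω} {Z : Hurst → ℝ≥0 → Ω → ℝ}

/-- This normalization makes `Z_H` a standard fractional Brownian motion. It is Euler's reflection
formula for `Γ(-2H) Γ(2H+1)` with the double-angle formula for the sine. The factor `cos(πH)` has to
be cancelled, and it is nonzero since `H ≠ 1/2`. -/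
theorem fieldConst_self {H : ℝ} (h0 : 0 < H) (h1 : H < 1) (hH : H ≠ 1 / 2) :
    fieldConst H H = 1 := by
  have hs : 0 < Real.sin (Real.pi * H) :=
    Real.sin_pos_of_pos_of_lt_pi (by positivity) (by nlinarith [Real.pi_pos])
  have hG : 0 < Real.Gamma (2 * H + 1) := Real.Gamma_pos_of_pos (by positivity)
  have href := Real.Gamma_mul_Gamma_one_sub (-(2 * H))
  rw [sub_neg_eq_add, show Real.pi * -(2 * H) = -(2 * (Real.pi * H)) by ring, Real.sin_neg,
    Real.sin_two_mul, add_comm 1] at href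
  have hc : Real.cos (Real.pi * H) ≠ 0 := by
    intro hc
    rw [Real.cos_eq_zero_iff] at hc
    obtain ⟨k, hk⟩ := hc
    have h2 : 2 * H = 2 * k + 1 := by
      have : Real.pi * (2 * H) = Real.pi * (2 * k + 1) := by linarith
      exact mul_left_cancel₀ Real.pi_ne_zero this
    have hk1 : -1 < k := by
      have : (-1 : ℝ) < k := by linarith
      exact_mod_cast this
    have hk2 : k < 1 := by
      have : (k : ℝ) < 1 := by linarith
      exact_mod_cast this
    have hk0 : k = 0 := by omega
    rw [hk0] at h2
    apply hH
    push_cast at h2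
    linarith
  rw [fieldConst, if_neg (fun h ↦ hH (by linarith)), sub_self, zero_mul, Real.cos_zero,
    show (H + H) * (Real.pi / 2) = Real.pi * H by ring, ← two_mul H]
  have hsq := Real.mul_self_sqrt (mul_pos hG hs).le
  calc _ = -(2 / Real.pi) * (√(Real.Gamma (2 * H + 1) * Real.sin (Real.pi * H))
        * √(Real.Gamma (2 * H + 1) * Real.sin (Real.pi * H))) * Real.Gamma (-(2 * H))
        * Real.cos (Real.pi * H) := by ring
    _ = -(2 / Real.pi) * (Real.Gamma (-(2 * H)) * Real.Gamma (2 * H + 1))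
        * (Real.sin (Real.pi * H) * Real.cos (Real.pi * H)) := by rw [hsq]; ring
    _ = 1 := by
      rw [href]
      field_simp [Real.pi_ne_zero]

theorem aConst_pos (H : Hurst) : 0 < aConst H := by
  have h0 := H.2.1
  have h1 := H.2.2
  have hs : 0 < Real.sin (Real.pi * H) :=
    Real.sin_pos_of_pos_of_lt_pi (by positivity) (by nlinarith [Real.pi_pos])
  have g1 : 0 < Real.Gamma (2 * H + 1) := Real.Gamma_pos_of_pos (by positivity)
  have g2 : 0 < Real.Gamma (3 - 2 * H) := Real.Gamma_pos_of_pos (by linarith)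
  rw [aConst, fieldConst, if_pos (by ring)]
  positivity

theorem cM_pos (H : Hurst) : 0 < cM H := by
  have h0 := H.2.1
  have h1 := H.2.2
  have ha := aConst_pos H
  have g1 : 0 < Real.Gamma (3 / 2 - H) := Real.Gamma_pos_of_pos (by linarith)
  have g2 : 0 < Real.Gamma (3 - 2 * H) := Real.Gamma_pos_of_pos (by linarith)
  have g3 : 0 < Real.Gamma (H + 1 / 2) := Real.Gamma_pos_of_pos (by linarith)
  rw [cM]
  positivity

theorem memLp_field (hZ : IsFractionalGaussianField Z P) (H : Hurst) (t : ℝ≥0) :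
    MemLp (Z H t) 2 P :=
  (hZ.gaussian.hasGaussianLaw_eval (H, t)).memLp_two

/-- The field as a family of vectors in `L²`. -/
def fieldLp (hZ : IsFractionalGaussianField Z P) (H : Hurst) (t : ℝ≥0) : Lp ℝ 2 P :=
  (memLp_field hZ H t).toLp

theorem coeFn_fieldLp (hZ : IsFractionalGaussianField Z P) (H : Hurst) (t : ℝ≥0) :
    fieldLp hZ H t =ᵐ[P] Z H t := (memLp_field hZ H t).coeFn_toLp

theorem inner_fieldLp (hZ : IsFractionalGaussianField Z P) (H H' : Hurst) (t s : ℝ≥0) :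
    inner ℝ (fieldLp hZ H t) (fieldLp hZ H' s) =
      fieldConst H H' / 2 * ((t : ℝ) ^ ((H : ℝ) + H') + (s : ℝ) ^ ((H : ℝ) + H')
        - |(t : ℝ) - s| ^ ((H : ℝ) + H')) := by
  rw [inner_eq_integral_of_ae_eq (coeFn_fieldLp hZ H t) (coeFn_fieldLp hZ H' s), hZ.covariance]

/-- The exponents add up to one, so the covariance is `(a_H / 2)(t + r - (t - r))`. It does not
depend on `t`, which is why the projections onto the pasts are consistent. -/
theorem inner_fieldLp_dual (hZ : IsFractionalGaussianField Z P) (H : Hurst) {t r : ℝ≥0}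
    (hr : r ≤ t) : inner ℝ (fieldLp hZ H.dual t) (fieldLp hZ H r) = aConst H * r := by
  have hr' : (r : ℝ) ≤ t := hr
  have e : (H : ℝ) + (H.dual : ℝ) = 1 := by rw [Hurst.dual]; ring
  rw [real_inner_comm, inner_fieldLp, e, Real.rpow_one, Real.rpow_one, Real.rpow_one,
    abs_of_nonpos (by linarith), aConst, Hurst.dual]
  ring

/-- The closed linear span of `Z_h(r)`, `r ≤ t`. -/
def pastSpan (hZ : IsFractionalGaussianField Z P) (H : Hurst) (t : ℝ≥0) :
    Submodule ℝ (Lp ℝ 2 P) :=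
  (Submodule.span ℝ (fieldLp hZ H '' Set.Iic t)).topologicalClosure

theorem pastSpan_mono (hZ : IsFractionalGaussianField Z P) (H : Hurst) {s t : ℝ≥0} (hst : s ≤ t) :
    pastSpan hZ H s ≤ pastSpan hZ H t :=
  Submodule.topologicalClosure_mono
    (Submodule.span_mono (Set.image_mono (Set.Iic_subset_Iic.2 hst)))

/-- The Gaussian Hilbert space generated by the field. -/
def gaussianSpan (hZ : IsFractionalGaussianField Z P) : Submodule ℝ (Lp ℝ 2 P) :=
  (Submodule.span ℝ (Set.range fun p : Hurst × ℝ≥0 ↦ fieldLp hZ p.1 p.2)).topologicalClosure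

theorem fieldLp_mem_gaussianSpan (hZ : IsFractionalGaussianField Z P) (H : Hurst) (t : ℝ≥0) :
    fieldLp hZ H t ∈ gaussianSpan hZ :=
  Submodule.le_topologicalClosure _ (Submodule.subset_span ⟨(H, t), rfl⟩)

theorem pastSpan_le_gaussianSpan (hZ : IsFractionalGaussianField Z P) (H : Hurst) (t : ℝ≥0) :
    pastSpan hZ H t ≤ gaussianSpan hZ := by
  refine Submodule.topologicalClosure_mono (Submodule.span_mono ?_)
  rintro _ ⟨r, -, rfl⟩
  exact ⟨(H, r), rfl⟩

theorem isCenteredGaussian_of_mem_gaussianSpan [IsProbabilityMeasure P]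
    (hZ : IsFractionalGaussianField Z P) {f : Lp ℝ 2 P} (hf : f ∈ gaussianSpan hZ) :
    IsCenteredGaussian f :=
  isCenteredGaussian_of_mem_closure_span hZ.gaussian (fun p ↦ hZ.centered p.1 p.2)
    (fun p ↦ coeFn_fieldLp hZ p.1 p.2) hf

theorem inner_eq_zero_of_mem_pastSpan (hZ : IsFractionalGaussianField Z P) {H : Hurst} {t : ℝ≥0}
    {v : Lp ℝ 2 P} (hv : ∀ r ≤ t, inner ℝ v (fieldLp hZ H r) = 0) {f : Lp ℝ 2 P}
    (hf : f ∈ pastSpan hZ H t) : inner ℝ v f = 0 := by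
  have hle : Submodule.span ℝ (fieldLp hZ H '' Set.Iic t) ≤ (Submodule.span ℝ {v})ᗮ := by
    rw [Submodule.span_le]
    rintro _ ⟨r, hr, rfl⟩
    exact Submodule.mem_orthogonal_singleton_iff_inner_right.2 (hv r hr)
  exact Submodule.mem_orthogonal_singleton_iff_inner_right.1
    (Submodule.topologicalClosure_minimal _ hle (Submodule.isClosed_orthogonal _) hf)

theorem sigmaField_le (hZ : IsFractionalGaussianField Z P) (H : Hurst) (t : ℝ≥0) :
    sigmaField Z H t ≤ (inferInstance : MeasurableSpace Ω) :=
  iSup₂_le fun r _ ↦ (hZ.measurable H r).comap_le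

theorem aestronglyMeasurable_of_mem_pastSpan (hZ : IsFractionalGaussianField Z P) {H : Hurst}
    {t : ℝ≥0} {f : Lp ℝ 2 P} (hf : f ∈ pastSpan hZ H t) :
    AEStronglyMeasurable[sigmaField Z H t] f P := by
  have hle : Submodule.span ℝ (fieldLp hZ H '' Set.Iic t) ≤ lpMeas ℝ ℝ (sigmaField Z H t) 2 P := by
    rw [Submodule.span_le]
    rintro _ ⟨r, hr, rfl⟩
    rw [SetLike.mem_coe, mem_lpMeas_iff_aestronglyMeasurable]
    have h1 : Measurable[sigmaField Z H t] (Z H r) :=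
      Measurable.mono (comap_measurable (Z H r))
        (le_iSup₂ (f := fun r (_ : r ≤ t) ↦ MeasurableSpace.comap (Z H r) inferInstance) r hr) le_rfl
    exact h1.stronglyMeasurable.aestronglyMeasurable.congr (coeFn_fieldLp hZ H r).symm
  have hc : IsClosed (lpMeas ℝ ℝ (sigmaField Z H t) 2 P : Set (Lp ℝ 2 P)) :=
    isClosed_aestronglyMeasurable (sigmaField_le hZ H t)
  exact mem_lpMeas_iff_aestronglyMeasurable.1
    (Submodule.topologicalClosure_minimal _ hle hc hf)

/-- In a Gaussian field, conditional expectation is orthogonal projection. -/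
theorem condExp_eq_of_orthogonal [IsProbabilityMeasure P] (hZ : IsFractionalGaussianField Z P)
    {H : Hurst} {t : ℝ≥0} {f p : Lp ℝ 2 P} (hf : f ∈ gaussianSpan hZ) (hp : p ∈ pastSpan hZ H t)
    (hfp : ∀ r ≤ t, inner ℝ (f - p) (fieldLp hZ H r) = 0) :
    P[f | sigmaField Z H t] =ᵐ[P] p := by
  have hfpS : f - p ∈ gaussianSpan hZ :=
    Submodule.sub_mem _ hf (pastSpan_le_gaussianSpan hZ H t hp)
  have hle := sigmaField_le hZ H t
  have hsm : StronglyMeasurable (f - p : Lp ℝ 2 P) := Lp.stronglyMeasurable _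
  -- The residual `f - p` is jointly Gaussian with the past and uncorrelated with it, hence
  -- independent of it. Its conditional expectation is then its mean, zero.
  have hGP : IsGaussianProcess (Sum.elim (fun _ : Unit ↦ ((f - p : Lp ℝ 2 P) : Ω → ℝ))
      (fun r : Set.Iic t ↦ Z H r)) P := by
    refine isGaussianProcess_of_mem (S := gaussianSpan hZ)
      (fun g hg ↦ isCenteredGaussian_of_mem_gaussianSpan hZ hg) ?_
    rintro (_ | r)
    · exact ⟨_, hfpS, ae_eq_refl _⟩
    · exact ⟨_, fieldLp_mem_gaussianSpan hZ H r, coeFn_fieldLp hZ H r⟩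
  have hind := hGP.indepFun_of_covariance_eq_zero (fun _ ↦ hsm.measurable.aemeasurable)
    (fun r ↦ (hZ.measurable H r).aemeasurable) (fun _ r ↦ by
      rw [covariance_eq_sub (Lp.memLp _) (memLp_field hZ H r),
        (isCenteredGaussian_of_mem_gaussianSpan hZ hfpS).integral_eq_zero, zero_mul, sub_zero,
        ← hfp r r.2, inner_eq_integral_of_ae_eq (ae_eq_refl _) (coeFn_fieldLp hZ H r)]
      rfl)
  have hφ : Measurable fun g : Unit → ℝ ↦ g () := measurable_pi_apply ()
  have hI : Indep (MeasurableSpace.comap (f - p : Lp ℝ 2 P) inferInstance) (sigmaField Z H t) P := by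
    have h1 := hind.comp hφ measurable_id
    rw [IndepFun_iff_Indep] at h1
    convert h1 using 1
    · rfl
    · rw [Function.id_comp, MeasurableSpace.comap_process_pi, iSup_subtype]
      rfl
  have h2 := condExp_indep_eq hsm.measurable.comap_le hle
    (comap_measurable (f - p : Lp ℝ 2 P)).stronglyMeasurable hI
  have h3 : P[p | sigmaField Z H t] =ᵐ[P] p :=
    condExp_of_aestronglyMeasurable' hle (aestronglyMeasurable_of_mem_pastSpan hZ hp)
      ((Lp.memLp p).integrable one_le_two)
  have h4 := condExp_add ((Lp.memLp (f - p)).integrable one_le_two)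
    ((Lp.memLp p).integrable one_le_two) (sigmaField Z H t)
  have h5 : ((f - p : Lp ℝ 2 P) : Ω → ℝ) + (p : Ω → ℝ) =ᵐ[P] f := by
    filter_upwards [Lp.coeFn_sub f p] with ω h
    rw [Pi.add_apply, h, Pi.sub_apply, sub_add_cancel]
  have h6 := condExp_congr_ae (m := sigmaField Z H t) h5
  filter_upwards [h2, h3, h4, h6] with ω e2 e3 e4 e6
  rw [← e6, e4, Pi.add_apply, e2, e3,
    (isCenteredGaussian_of_mem_gaussianSpan hZ hfpS).integral_eq_zero, zero_add]

/-- For `t > 0`, self-similarity reduces to `[0, 1]`: `s ↦ t^{-H} Z_H(ts)` is again a fractional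
Brownian motion. If `Y` is its fundamental vector, then `p = a_H t^{1-H} Y`; the factor `t^{1-H}`
undoes both rescalings, and its square gives `t^{2-2H}` in the norm. -/
theorem exists_projection (hZ : IsFractionalGaussianField Z P) {H : Hurst} (hH : (H : ℝ) ≠ 1 / 2)
    (t : ℝ≥0) : ∃ p ∈ pastSpan hZ H t, (∀ r ≤ t, inner ℝ p (fieldLp hZ H r) = aConst H * r) ∧
      inner ℝ p p = cM H * (t : ℝ) ^ (2 - 2 * (H : ℝ)) := by
  have h0 : 0 < (H : ℝ) := H.2.1
  have h1 : (H : ℝ) < 1 := H.2.2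
  have hfc := fieldConst_self h0 h1 hH
  rcases eq_or_ne t 0 with rfl | ht
  · refine ⟨0, Submodule.zero_mem _, fun r hr ↦ ?_, ?_⟩
    · rw [nonpos_iff_eq_zero.1 hr]
      simp
    · rw [NNReal.coe_zero, Real.zero_rpow (by linarith)]
      simp
  have ht' : 0 < (t : ℝ) := by positivity
  set X : ℝ → Lp ℝ 2 P := fun s ↦ ((t : ℝ) ^ (-(H : ℝ))) • fieldLp hZ H (t * s.toNNReal) with hXdef
  have htt : (t : ℝ) ^ (-(H : ℝ)) * (t : ℝ) ^ (H : ℝ) = 1 := by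
    rw [← Real.rpow_add ht', neg_add_cancel, Real.rpow_zero]
  have hX : ∀ s ∈ Set.Icc (0 : ℝ) 1, ∀ r ∈ Set.Icc (0 : ℝ) 1,
      inner ℝ (X s) (X r) = fbmCov H s r := by
    intro s hs r hr
    rw [hXdef, real_inner_smul_left, real_inner_smul_right, inner_fieldLp, hfc, NNReal.coe_mul,
      NNReal.coe_mul, Real.coe_toNNReal _ hs.1, Real.coe_toNNReal _ hr.1, ← mul_sub, abs_mul,
      abs_of_pos ht', Real.mul_rpow ht'.le hs.1, Real.mul_rpow ht'.le hr.1,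
      Real.mul_rpow ht'.le (abs_nonneg _), fbmCov, ← two_mul]
    have e : (t : ℝ) ^ (-(H : ℝ)) * ((t : ℝ) ^ (-(H : ℝ)) * (t : ℝ) ^ (2 * (H : ℝ))) = 1 := by
      rw [← Real.rpow_add ht', ← Real.rpow_add ht']
      ring_nf
      rw [Real.rpow_zero]
    linear_combination (s ^ (2 * (H : ℝ)) + r ^ (2 * (H : ℝ)) - |s - r| ^ (2 * (H : ℝ))) / 2 * e
  obtain ⟨Y, hYmem, hYX, hYY⟩ := exists_fundamental_vector h0 h1 hX
  have ht2 : (t : ℝ) ^ (1 - (H : ℝ)) = t * (t : ℝ) ^ (-(H : ℝ)) := by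
    rw [sub_eq_add_neg, Real.rpow_add ht', Real.rpow_one]
  refine ⟨(aConst H * (t : ℝ) ^ (1 - (H : ℝ))) • Y, Submodule.smul_mem _ _ ?_, fun r hr ↦ ?_, ?_⟩
  · refine Submodule.topologicalClosure_mono ?_ hYmem
    rw [Submodule.span_le]
    rintro _ ⟨s, hs, rfl⟩
    refine Submodule.smul_mem _ _ (Submodule.subset_span ⟨_, ?_, rfl⟩)
    have h2 : s.toNNReal ≤ 1 := Real.toNNReal_le_one.2 hs.2
    exact (mul_le_mul_right h2 t).trans_eq (mul_one t)
  · have hr' : (r : ℝ) ≤ t := hr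
    have h2 := hYX (r / t) ⟨by positivity, (div_le_one ht').2 hr'⟩
    have h3 : t * ((r : ℝ) / t).toNNReal = r := by
      rw [← NNReal.coe_div, Real.toNNReal_coe, mul_div_cancel₀ _ ht]
    rw [hXdef] at h2
    simp only [h3] at h2
    rw [real_inner_smul_right] at h2
    rw [real_inner_smul_left, ht2]
    calc _ = aConst H * t * ((t : ℝ) ^ (-(H : ℝ)) * inner ℝ Y (fieldLp hZ H r)) := by ring
      _ = aConst H * r := by rw [h2]; field_simp
  · have h4 : (t : ℝ) ^ (2 - 2 * (H : ℝ)) = (t : ℝ) ^ (1 - (H : ℝ)) * (t : ℝ) ^ (1 - (H : ℝ)) := by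
      rw [← Real.rpow_add ht']
      congr 1; ring
    rw [real_inner_smul_left, real_inner_smul_right, hYY, cM, h4]
    ring

/-- For `s ≤ t` the vectors `m s` and `m t` pair equally with the past up to `s`. So `m t - m s` is
orthogonal to `m s`, and the covariance is the variance at the earlier time. -/
theorem exists_martingaleLp [IsProbabilityMeasure P] (hZ : IsFractionalGaussianField Z P)
    {H : Hurst} (hH : (H : ℝ) ≠ 1 / 2) {M : ℝ≥0 → Ω → ℝ} (hM : IsProjectedMartingale Z P H M) :
    ∃ m : ℝ≥0 → Lp ℝ 2 P, (∀ t, m t =ᵐ[P] M t) ∧ (∀ t, m t ∈ pastSpan hZ H t) ∧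
      ∀ s t, inner ℝ (m s) (m t) = cM H * (min (s : ℝ) t) ^ (2 - 2 * (H : ℝ)) := by
  choose m hmem hmr hmm using fun t ↦ exists_projection hZ hH t
  refine ⟨m, fun t ↦ ?_, hmem, ?_⟩
  · have h1 := condExp_eq_of_orthogonal hZ (fieldLp_mem_gaussianSpan hZ H.dual t) (hmem t)
      (fun r hr ↦ by rw [inner_sub_left, inner_fieldLp_dual hZ H hr, hmr t r hr, sub_self])
    have h2 := condExp_congr_ae (m := sigmaField Z H t) (coeFn_fieldLp hZ H.dual t)
    exact (h1.symm.trans h2).trans (hM.ae_eq_condExp t).symm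
  · have key : ∀ s t, s ≤ t →
        inner ℝ (m s) (m t) = cM H * (min (s : ℝ) t) ^ (2 - 2 * (H : ℝ)) := by
      intro s t hst
      have h3 : inner ℝ (m t - m s) (m s) = 0 :=
        inner_eq_zero_of_mem_pastSpan hZ (fun r hr ↦ by
          rw [inner_sub_left, hmr t r (hr.trans hst), hmr s r hr, sub_self]) (hmem s)
      rw [inner_sub_left, hmm s, real_inner_comm, sub_eq_zero] at h3
      rw [h3, min_eq_left (NNReal.coe_le_coe.2 hst)]
    intro s t
    rcases le_total s t with h | h
    · exact key s t h
    · rw [real_inner_comm, min_comm, key t s h]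

end Field

/-! ### Wiener integrals of deterministic functions -/

section Wiener

theorem StepData.memLp_toFun (g : StepData) (μ : Measure ℝ) [IsFiniteMeasure μ] :
    MemLp g.toFun 2 μ := by
  have h : g.toFun = fun s ↦ ∑ i ∈ Finset.range g.n,
      (Set.Ioc (g.knot i : ℝ) (g.knot (i + 1) : ℝ)).indicator (fun _ ↦ g.val i) s := rfl
  rw [h]
  exact memLp_finsetSum _ fun i _ ↦
    memLp_indicator_const 2 measurableSet_Ioc _ (Or.inr (measure_ne_top _ _))

/-- The step function with the values of `φ` at the left end points of `n` equal subintervals. -/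
def leftStep (φ : ℝ → ℝ) (t : ℝ≥0) (n : ℕ) : StepData where
  n := n
  knot i := (min i n : ℕ) * t / n
  mono i j hij := by
    have h : ((min i n : ℕ) : ℝ≥0) ≤ (min j n : ℕ) := Nat.cast_le.2 (min_le_min_right n hij)
    change ((min i n : ℕ) : ℝ≥0) * t / n ≤ (min j n : ℕ) * t / n
    gcongr
  val i := φ (((min i n : ℕ) * t / n : ℝ≥0) : ℝ)

theorem exists_step_near {φ : ℝ → ℝ} (hφ : Continuous φ) (t : ℝ≥0) {ε : ℝ} (hε : 0 < ε) :
    ∃ g : StepData, (∀ i, g.knot i ≤ t) ∧ ∀ s ∈ Set.Ioc (0 : ℝ) t, |φ s - g.toFun s| ≤ ε := by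
  have hu := isCompact_Icc.uniformContinuousOn_of_continuous (hφ.continuousOn (s := Set.Icc (0 : ℝ) t))
  rw [Metric.uniformContinuousOn_iff] at hu
  obtain ⟨δ, hδ, hu⟩ := hu ε hε
  obtain ⟨n, hn⟩ := exists_nat_gt ((t : ℝ) / δ)
  have hn0 : 0 < (n : ℝ) := lt_of_le_of_lt (by positivity) hn
  have hn0' : n ≠ 0 := by rintro rfl; simp at hn0
  have hstep : (t : ℝ) / n < δ := by
    rw [div_lt_iff₀ hδ] at hn
    rw [div_lt_iff₀ hn0, mul_comm]
    exact hn
  set g := leftStep φ t n with hg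
  -- The bound is required for every index. Knots beyond `n` also stay at `t`, because `leftStep`
  -- clamps the index.
  have hk : ∀ i, g.knot i ≤ t := fun i ↦ by
    have h1 : ((min i n : ℕ) : ℝ≥0) ≤ n := by exact_mod_cast min_le_right i n
    calc g.knot i = (min i n : ℕ) * t / n := rfl
      _ ≤ n * t / n := by gcongr
      _ = t := by rw [mul_div_cancel_left₀]; exact_mod_cast hn0'
  have hki : ∀ i ≤ n, (g.knot i : ℝ) = i * t / n := fun i hi ↦ by
    have : g.knot i = (min i n : ℕ) * t / n := rfl
    rw [this, min_eq_left hi]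
    push_cast
    rfl
  refine ⟨g, hk, fun s hs ↦ ?_⟩
  have ht0 : 0 < (t : ℝ) := hs.1.trans_le hs.2
  have hx0 : 0 < s * n / t := by have := hs.1; positivity
  have hxn : s * n / t ≤ n := by
    rw [div_le_iff₀ ht0, mul_comm]
    exact mul_le_mul_of_nonneg_left hs.2 hn0.le
  -- The cells are open on the left and closed on the right, so the cell of `s` is found by rounding
  -- up and subtracting one.
  obtain ⟨i, hi⟩ : ∃ i, ⌈s * n / t⌉₊ = i + 1 :=
    Nat.exists_eq_succ_of_ne_zero (Nat.ceil_pos.2 hx0).ne'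
  have hin : i + 1 ≤ n := hi ▸ Nat.ceil_le.2 hxn
  have h1 : s * n / t ≤ (i : ℝ) + 1 := by
    have := Nat.le_ceil (s * n / t)
    rw [hi] at this
    exact_mod_cast this
  have h2 : (i : ℝ) < s * n / t := by
    have : i < ⌈s * n / t⌉₊ := by omega
    exact Nat.lt_ceil.1 this
  have hmem : s ∈ Set.Ioc (g.knot i : ℝ) (g.knot (i + 1)) := by
    rw [hki i (by omega), hki (i + 1) hin]
    rw [lt_div_iff₀ ht0] at h2
    rw [div_le_iff₀ ht0] at h1
    constructor
    · rw [div_lt_iff₀ hn0]; exact h2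
    · rw [le_div_iff₀ hn0]; push_cast; exact h1
  have hmono : Monotone fun i ↦ (g.knot i : ℝ) := fun a b h ↦ NNReal.coe_le_coe.2 (g.mono h)
  have hval : g.toFun s = g.val i := by
    rw [StepData.toFun, Finset.sum_eq_single i, Set.indicator_of_mem hmem]
    · intro j _ hj
      refine Set.indicator_of_notMem (fun hjm ↦ ?_) _
      exact Set.disjoint_left.1 (hmono.pairwise_disjoint_on_Ioc_succ hj) hjm hmem
    · intro h
      exact absurd (Finset.mem_range.2 (show i < n by omega)) h
  have hval' : g.val i = φ (g.knot i) := rfl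
  rw [hval, hval', ← Real.dist_eq]
  have hlt : (g.knot i : ℝ) < s := hmem.1
  refine (hu s ⟨hs.1.le, hs.2⟩ _ ⟨(g.knot i).coe_nonneg, NNReal.coe_le_coe.2 (hk i)⟩ ?_).le
  rw [Real.dist_eq, abs_of_pos (sub_pos.2 hlt)]
  have h3 := hmem.2
  rw [hki (i + 1) hin] at h3
  rw [hki i (by omega)]
  calc s - i * t / n ≤ ((i + 1 : ℕ) : ℝ) * t / n - i * t / n := by linarith
    _ = t / n := by push_cast; ring
    _ < δ := hstep

theorem exists_step_eLpNorm_le {f : ℝ → ℝ} {t : ℝ≥0}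
    (hf : MemLp f 2 (volume.restrict (Set.Ioc (0 : ℝ) t))) {η : ℝ≥0∞} (hη : η ≠ 0) :
    ∃ g : StepData, (∀ i, g.knot i ≤ t) ∧
      eLpNorm (fun s ↦ f s - g.toFun s) 2 (volume.restrict (Set.Ioc (0 : ℝ) t)) ≤ η := by
  set μ := volume.restrict (Set.Ioc (0 : ℝ) t) with hμ
  have hη2 : η / 2 ≠ 0 := (ENNReal.half_pos hη).ne'
  obtain ⟨φ, -, h1, hφ, hφL⟩ := hf.exists_hasCompactSupport_eLpNorm_sub_le (by norm_num) hη2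
  obtain ⟨ε, hε, h2⟩ := ENNReal.exists_nnreal_pos_mul_lt
    (a := μ Set.univ ^ (2 : ℝ≥0∞).toReal⁻¹) (ENNReal.rpow_ne_top_of_nonneg (by positivity)
      (measure_ne_top _ _)) hη2
  obtain ⟨g, hg, h3⟩ := exists_step_near hφ t (ε := ε) (by exact_mod_cast hε)
  refine ⟨g, hg, ?_⟩
  have h4 : eLpNorm (φ - g.toFun) 2 μ ≤ η / 2 := by
    refine (eLpNorm_le_of_ae_bound (C := (ε : ℝ)) ?_).trans ?_
    · rw [hμ, ae_restrict_iff' measurableSet_Ioc]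
      exact ae_of_all _ fun s hs ↦ h3 s hs
    · rw [ENNReal.ofReal_coe_nnreal, mul_comm]
      exact h2.le
  have h5 : (fun s ↦ f s - g.toFun s) = (f - φ) + (φ - g.toFun) := by
    ext s; simp
  rw [h5]
  calc _ ≤ eLpNorm (f - φ) 2 μ + eLpNorm (φ - g.toFun) 2 μ :=
        eLpNorm_add_le (hf.1.sub hφL.1) (hφL.1.sub (g.memLp_toFun μ).1) (by norm_num)
    _ ≤ η / 2 + η / 2 := add_le_add h1 h4
    _ = η := ENNReal.add_halves η

variable {P : Measure Ω} {W : ℝ≥0 → Ω → ℝ} {w : ℝ≥0 → Lp ℝ 2 P}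

/-- The elementary integral as a vector in `L²`. -/
def StepData.integralLp (g : StepData) (w : ℝ≥0 → Lp ℝ 2 P) : Lp ℝ 2 P :=
  ∑ i ∈ Finset.range g.n, g.val i • (w (g.knot (i + 1)) - w (g.knot i))

theorem StepData.coeFn_integralLp (g : StepData) (hw : ∀ t, w t =ᵐ[P] W t) :
    g.integralLp w =ᵐ[P] g.integral W := by
  refine coeFn_sum_smul (x := fun i ↦ w (g.knot (i + 1)) - w (g.knot i))
    (X := fun i ω ↦ W (g.knot (i + 1)) ω - W (g.knot i) ω) _ _ fun i ↦ ?_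
  filter_upwards [Lp.coeFn_sub (w (g.knot (i + 1))) (w (g.knot i)), hw (g.knot (i + 1)),
    hw (g.knot i)] with ω h1 h2 h3
  rw [h1, Pi.sub_apply, h2, h3]

theorem inner_integralLp {v : Lp ℝ 2 P} {ψ : ℝ → ℝ} {t : ℝ≥0}
    (hψ : IntegrableOn ψ (Set.Ioc (0 : ℝ) t))
    (h : ∀ s ≤ t, inner ℝ v (w s) = ∫ x in (0 : ℝ)..s, ψ x) (g : StepData)
    (hg : ∀ i, g.knot i ≤ t) :
    inner ℝ v (g.integralLp w) = ∫ x in Set.Ioc (0 : ℝ) t, ψ x * g.toFun x := by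
  have hsub : ∀ i, Set.Ioc (g.knot i : ℝ) (g.knot (i + 1)) ⊆ Set.Ioc (0 : ℝ) t := fun i ↦
    Set.Ioc_subset_Ioc (g.knot i).coe_nonneg (NNReal.coe_le_coe.2 (hg (i + 1)))
  have hpt : ∀ x, ψ x * g.toFun x = ∑ i ∈ Finset.range g.n,
      (Set.Ioc (g.knot i : ℝ) (g.knot (i + 1))).indicator (fun x ↦ g.val i * ψ x) x := fun x ↦ by
    rw [StepData.toFun, Finset.mul_sum]
    refine Finset.sum_congr rfl fun i _ ↦ ?_
    by_cases hx : x ∈ Set.Ioc (g.knot i : ℝ) (g.knot (i + 1))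
    · rw [Set.indicator_of_mem hx, Set.indicator_of_mem hx, mul_comm]
    · rw [Set.indicator_of_notMem hx, Set.indicator_of_notMem hx, mul_zero]
  simp only [hpt]
  rw [integral_finsetSum _ fun i _ ↦ (hψ.const_mul _).indicator measurableSet_Ioc,
    StepData.integralLp, inner_sum]
  refine Finset.sum_congr rfl fun i _ ↦ ?_
  have hle : (g.knot i : ℝ) ≤ g.knot (i + 1) := NNReal.coe_le_coe.2 (g.mono (Nat.le_succ i))
  have hint : ∀ j, IntervalIntegrable ψ volume 0 (g.knot j) := fun j ↦ by
    rw [intervalIntegrable_iff_integrableOn_Ioc_of_le (g.knot j).coe_nonneg]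
    exact hψ.mono_set (Set.Ioc_subset_Ioc_right (NNReal.coe_le_coe.2 (hg j)))
  rw [setIntegral_indicator measurableSet_Ioc, Set.inter_eq_right.2 (hsub i),
    real_inner_smul_right, inner_sub_right, h _ (hg _), h _ (hg _),
    intervalIntegral.integral_interval_sub_left (hint _) (hint _),
    intervalIntegral.integral_of_le hle, integral_const_mul]

/-- One-sided form of the isometry: the density `ψ` of the pairings of `v` with the increments of
`w` determines the pairing of `v` with every Wiener integral. By linearity this holds for step
functions, then in the `L²` limit. The vector `v` need not itself be an integral; it is taken to be
a value of `w`, the constant 1, the martingale, or another Wiener integral. -/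
theorem IsWienerIntegral.inner_eq {v x : Lp ℝ 2 P} {ψ f : ℝ → ℝ} {t : ℝ≥0} {I : Ω → ℝ}
    (hI : IsWienerIntegral W P f t I) (hw : ∀ t, w t =ᵐ[P] W t) (hx : x =ᵐ[P] I)
    (hf : MemLp f 2 (volume.restrict (Set.Ioc (0 : ℝ) t)))
    (hψ : MemLp ψ 2 (volume.restrict (Set.Ioc (0 : ℝ) t)))
    (h : ∀ s ≤ t, inner ℝ v (w s) = ∫ x in (0 : ℝ)..s, ψ x) :
    inner ℝ v x = ∫ x in Set.Ioc (0 : ℝ) t, ψ x * f x := by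
  obtain ⟨g, hg, hgf, hgI⟩ := hI.approx
  have h1 : Tendsto (fun k ↦ (g k).integralLp w) atTop (𝓝 x) := by
    rw [Lp.tendsto_Lp_iff_tendsto_eLpNorm']
    refine hgI.congr fun k ↦ ?_
    rw [← eLpNorm_neg]
    refine eLpNorm_congr_ae ?_
    filter_upwards [(g k).coeFn_integralLp hw, hx] with ω e1 e2
    simp only [Pi.neg_apply, Pi.sub_apply]
    rw [e1, e2]
    ring
  have h2 : Tendsto (fun k ↦ ((g k).memLp_toFun (volume.restrict (Set.Ioc (0 : ℝ) t))).toLp)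
      atTop (𝓝 hf.toLp) := by
    rw [Lp.tendsto_Lp_iff_tendsto_eLpNorm'']
    refine hgf.congr fun k ↦ ?_
    rw [← eLpNorm_neg]
    congr 1
    ext s
    simp
  have h3 : Tendsto (fun k ↦ inner ℝ v ((g k).integralLp w)) atTop (𝓝 (inner ℝ v x)) :=
    tendsto_const_nhds.inner h1
  have h4 := (tendsto_const_nhds (x := hψ.toLp)).inner (𝕜 := ℝ) h2
  rw [inner_eq_integral_of_ae_eq hψ.coeFn_toLp hf.coeFn_toLp] at h4
  refine tendsto_nhds_unique h3 (h4.congr fun k ↦ ?_)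
  rw [inner_eq_integral_of_ae_eq hψ.coeFn_toLp (MemLp.coeFn_toLp _),
    inner_integralLp (hψ.integrable one_le_two) h (g k) (hg k)]

theorem memLp_indicator_one (r : ℝ≥0) (μ : Measure ℝ) [IsFiniteMeasure μ] :
    MemLp ((Set.Ioc (0 : ℝ) r).indicator fun _ ↦ (1 : ℝ)) 2 μ :=
  memLp_indicator_const 2 measurableSet_Ioc _ (Or.inr (measure_ne_top _ _))

theorem integral_indicator_mul (f : ℝ → ℝ) (r t : ℝ≥0) :
    ∫ x in Set.Ioc (0 : ℝ) t, (Set.Ioc (0 : ℝ) r).indicator (fun _ ↦ (1 : ℝ)) x * f x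
      = ∫ x in Set.Ioc (0 : ℝ) (min (t : ℝ) r), f x := by
  have : (fun x ↦ (Set.Ioc (0 : ℝ) r).indicator (fun _ ↦ (1 : ℝ)) x * f x)
      = (Set.Ioc (0 : ℝ) r).indicator f := by
    ext x
    by_cases hx : x ∈ Set.Ioc (0 : ℝ) r
    · simp [hx]
    · simp [hx]
  rw [this, setIntegral_indicator measurableSet_Ioc, Set.Ioc_inter_Ioc, max_self]

theorem inner_eq_integral_indicator (hB : ∀ r s, inner ℝ (w r) (w s) = ((min r s : ℝ≥0) : ℝ))
    (r s : ℝ≥0) : inner ℝ (w r) (w s)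
      = ∫ x in (0 : ℝ)..s, (Set.Ioc (0 : ℝ) r).indicator (fun _ ↦ (1 : ℝ)) x := by
  have := integral_indicator_mul (fun _ ↦ 1) r s
  simp only [mul_one] at this
  rw [hB, intervalIntegral.integral_of_le s.coe_nonneg, this]
  simp [min_comm]

theorem IsWienerIntegral.inner_left (hB : ∀ r s, inner ℝ (w r) (w s) = ((min r s : ℝ≥0) : ℝ))
    {x : Lp ℝ 2 P} {f : ℝ → ℝ} {t : ℝ≥0} {I : Ω → ℝ}
    (hI : IsWienerIntegral W P f t I) (hw : ∀ t, w t =ᵐ[P] W t) (hx : x =ᵐ[P] I)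
    (hf : MemLp f 2 (volume.restrict (Set.Ioc (0 : ℝ) t))) (r : ℝ≥0) :
    inner ℝ (w r) x = ∫ x in Set.Ioc (0 : ℝ) (min (t : ℝ) r), f x := by
  rw [hI.inner_eq hw hx hf (memLp_indicator_one r _)
    (fun s _ ↦ inner_eq_integral_indicator hB r s), integral_indicator_mul]

/-- The Itô isometry. -/
theorem IsWienerIntegral.inner_inner (hB : ∀ r s, inner ℝ (w r) (w s) = ((min r s : ℝ≥0) : ℝ))
    {x y : Lp ℝ 2 P} {f g : ℝ → ℝ} {t s : ℝ≥0} {I J : Ω → ℝ}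
    (hI : IsWienerIntegral W P f t I) (hJ : IsWienerIntegral W P g s J)
    (hw : ∀ t, w t =ᵐ[P] W t) (hx : x =ᵐ[P] I) (hy : y =ᵐ[P] J)
    (hf : MemLp f 2 (volume.restrict (Set.Ioc (0 : ℝ) t)))
    (hg : MemLp g 2 (volume.restrict (Set.Ioc (0 : ℝ) s))) :
    inner ℝ x y = ∫ u in Set.Ioc (0 : ℝ) (min (t : ℝ) s), f u * g u := by
  -- The two integrals may have different horizons. The density belonging to `x` is `f` cut off at
  -- its own horizon `t`.
  have hψ : MemLp ((Set.Ioc (0 : ℝ) t).indicator f) 2 (volume.restrict (Set.Ioc (0 : ℝ) s)) := by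
    have : MemLp ((Set.Ioc (0 : ℝ) t).indicator f) 2 volume :=
      (memLp_indicator_iff_restrict measurableSet_Ioc).2 hf
    exact this.restrict _
  rw [hJ.inner_eq hw hy hg hψ fun r _ ↦ ?_]
  · have : (fun x ↦ (Set.Ioc (0 : ℝ) t).indicator f x * g x)
        = (Set.Ioc (0 : ℝ) t).indicator fun x ↦ f x * g x := by
      ext x
      by_cases hx : x ∈ Set.Ioc (0 : ℝ) t
      · simp [hx]
      · simp [hx]
    rw [this, setIntegral_indicator measurableSet_Ioc, Set.Ioc_inter_Ioc, max_self, min_comm]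
  · rw [real_inner_comm, hI.inner_left hB hw hx hf, intervalIntegral.integral_of_le r.coe_nonneg,
      setIntegral_indicator measurableSet_Ioc, Set.Ioc_inter_Ioc, max_self, min_comm]

theorem inner_integralLp_integralLp (hB : ∀ r s, inner ℝ (w r) (w s) = ((min r s : ℝ≥0) : ℝ))
    {t : ℝ≥0} (g g' : StepData) (hg : ∀ i, g.knot i ≤ t) (hg' : ∀ i, g'.knot i ≤ t) :
    inner ℝ (g.integralLp w) (g'.integralLp w)
      = ∫ x in Set.Ioc (0 : ℝ) t, g.toFun x * g'.toFun x := by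
  refine inner_integralLp ((g.memLp_toFun _).integrable one_le_two) (fun s hs ↦ ?_) g' hg'
  rw [real_inner_comm, inner_integralLp ((memLp_indicator_one s _).integrable one_le_two)
    (fun r _ ↦ inner_eq_integral_indicator hB s r) g hg, integral_indicator_mul,
    intervalIntegral.integral_of_le s.coe_nonneg, min_eq_right (NNReal.coe_le_coe.2 hs)]

/-- Elementary integrals lie at the same mutual distances as their step functions in `L²([0, t])`,
so approximating step functions have Cauchy integrals and completeness supplies the limit. -/
theorem exists_isWienerIntegral (hB : ∀ r s, inner ℝ (w r) (w s) = ((min r s : ℝ≥0) : ℝ))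
    (hw : ∀ t, w t =ᵐ[P] W t) {f : ℝ → ℝ} {t : ℝ≥0}
    (hf : MemLp f 2 (volume.restrict (Set.Ioc (0 : ℝ) t))) :
    ∃ I, IsWienerIntegral W P f t I := by
  have hη : ∀ k : ℕ, ((k : ℝ≥0∞) + 1)⁻¹ ≠ 0 := fun k ↦
    ENNReal.inv_ne_zero.2 (by finiteness)
  choose g hg hgf using fun k : ℕ ↦ exists_step_eLpNorm_le hf (hη k)
  set μ := volume.restrict (Set.Ioc (0 : ℝ) t) with hμ
  have hlim : Tendsto (fun k ↦ eLpNorm (fun s ↦ f s - (g k).toFun s) 2 μ) atTop (𝓝 0) := by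
    refine tendsto_of_tendsto_of_tendsto_of_le_of_le tendsto_const_nhds ?_ (fun _ ↦ zero_le) hgf
    have h1 : Tendsto (fun k : ℕ ↦ ((k + 1 : ℕ) : ℝ≥0∞)⁻¹) atTop (𝓝 0) :=
      ENNReal.tendsto_inv_nat_nhds_zero.comp (tendsto_add_atTop_nat 1)
    simpa using h1
  set G : ℕ → Lp ℝ 2 μ := fun k ↦ ((g k).memLp_toFun μ).toLp with hG
  have h2 : Tendsto G atTop (𝓝 hf.toLp) := by
    rw [hG, Lp.tendsto_Lp_iff_tendsto_eLpNorm'']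
    refine hlim.congr fun k ↦ ?_
    rw [← eLpNorm_neg]
    congr 1
    ext s
    simp
  have hinner : ∀ k l, inner ℝ ((g k).integralLp w) ((g l).integralLp w) = inner ℝ (G k) (G l) :=
    fun k l ↦ by
      rw [inner_integralLp_integralLp hB _ _ (hg k) (hg l),
        inner_eq_integral_of_ae_eq (MemLp.coeFn_toLp _) (MemLp.coeFn_toLp _)]
  have hdist : ∀ k l, dist ((g k).integralLp w) ((g l).integralLp w) = dist (G k) (G l) :=
    fun k l ↦ by
      rw [dist_eq_norm, dist_eq_norm, ← sq_eq_sq₀ (norm_nonneg _) (norm_nonneg _),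
        norm_sub_sq_real, norm_sub_sq_real, hinner, ← real_inner_self_eq_norm_sq,
        ← real_inner_self_eq_norm_sq, ← real_inner_self_eq_norm_sq, ← real_inner_self_eq_norm_sq,
        hinner, hinner]
  have hc : CauchySeq fun k ↦ (g k).integralLp w := by
    have := h2.cauchySeq
    rw [Metric.cauchySeq_iff] at this ⊢
    simpa only [hdist] using this
  obtain ⟨x, hx⟩ := cauchySeq_tendsto_of_complete hc
  refine ⟨x, Lp.memLp x, g, hg, hlim, ?_⟩
  rw [Lp.tendsto_Lp_iff_tendsto_eLpNorm'] at hx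
  refine hx.congr fun k ↦ ?_
  rw [← eLpNorm_neg]
  refine eLpNorm_congr_ae ?_
  filter_upwards [(g k).coeFn_integralLp hw] with ω e1
  simp only [Pi.neg_apply, Pi.sub_apply]
  rw [e1]
  ring

theorem isWienerIntegral_wienerIntegral
    (hB : ∀ r s, inner ℝ (w r) (w s) = ((min r s : ℝ≥0) : ℝ))
    (hw : ∀ t, w t =ᵐ[P] W t) {f : ℝ → ℝ} {t : ℝ≥0}
    (hf : MemLp f 2 (volume.restrict (Set.Ioc (0 : ℝ) t))) :
    IsWienerIntegral W P f t (wienerIntegral W P f t) := by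
  have h := exists_isWienerIntegral hB hw hf
  rw [wienerIntegral, dif_pos h]
  exact h.choose_spec

/-- The mean is the inner product with the constant 1, whose density against `w` is `ψ = 0`. -/
theorem IsWienerIntegral.integral_eq_zero [IsProbabilityMeasure P] {x : Lp ℝ 2 P} {f : ℝ → ℝ}
    {t : ℝ≥0} {I : Ω → ℝ} (hI : IsWienerIntegral W P f t I) (hw : ∀ t, w t =ᵐ[P] W t)
    (hx : x =ᵐ[P] I) (hf : MemLp f 2 (volume.restrict (Set.Ioc (0 : ℝ) t)))
    (h0 : ∀ s, ∫ ω, W s ω ∂P = 0) : ∫ ω, I ω ∂P = 0 := by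
  set one : Lp ℝ 2 P := (memLp_const (1 : ℝ)).toLp with hone
  have h1 : ∀ {y : Lp ℝ 2 P} {Y : Ω → ℝ}, y =ᵐ[P] Y → inner ℝ one y = ∫ ω, Y ω ∂P :=
    fun hy ↦ by
      rw [inner_eq_integral_of_ae_eq (MemLp.coeFn_toLp _) hy]
      simp
  rw [← h1 hx, hI.inner_eq hw hx hf (ψ := fun _ ↦ 0) (by simp) fun s _ ↦ by rw [h1 (hw s), h0]; simp]
  simp

end Wiener

/-! ### The driving Brownian motion -/

section Driving

theorem integrableOn_rpow {c : ℝ} (hc : -1 < c) (t : ℝ≥0) :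
    IntegrableOn (fun u : ℝ ↦ u ^ c) (Set.Ioc (0 : ℝ) t) :=
  (intervalIntegrable_iff_integrableOn_Ioc_of_le t.coe_nonneg).1
    (intervalIntegral.intervalIntegrable_rpow' hc)

theorem setIntegral_rpow {c : ℝ} (hc : -1 < c) (t : ℝ≥0) :
    ∫ u in Set.Ioc (0 : ℝ) t, u ^ c = (t : ℝ) ^ (c + 1) / (c + 1) := by
  rw [← intervalIntegral.integral_of_le t.coe_nonneg, integral_rpow (Or.inl hc),
    Real.zero_rpow (by linarith), sub_zero]

theorem memLp_rpow {c : ℝ} (hc : -1 < 2 * c) (t : ℝ≥0) :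
    MemLp (fun u : ℝ ↦ u ^ c) 2 (volume.restrict (Set.Ioc (0 : ℝ) t)) := by
  have hm : Measurable fun u : ℝ ↦ u ^ c := by fun_prop
  rw [memLp_two_iff_integrable_sq hm.aestronglyMeasurable]
  refine IntegrableOn.congr_fun (integrableOn_rpow hc t) (fun u hu ↦ ?_) measurableSet_Ioc
  rw [mul_comm, Real.rpow_mul hu.1.le, Real.rpow_two]

/-- `∫_0^t r^q dF(r)` for `F(r) = min(r, s)^p`, through integration by parts. -/
theorem rpow_mul_min_sub_integral {p q : ℝ} (hp : 0 < p) (hq : q ≠ 0) (hpq : 0 < p + q)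
    (s t : ℝ≥0) :
    (t : ℝ) ^ q * (min (t : ℝ) s) ^ p
        - q * ∫ r in Set.Ioc (0 : ℝ) t, r ^ (q - 1) * (min r s) ^ p
      = p / (p + q) * (min (t : ℝ) s) ^ (p + q) := by
  have hadd : ∀ x : ℝ, 0 ≤ x → x ^ (p + q) = x ^ p * x ^ q := fun x hx ↦
    Real.rpow_add' hx hpq.ne'
  have hle : ∀ t : ℝ≥0, t ≤ s → ∫ r in Set.Ioc (0 : ℝ) t, r ^ (q - 1) * (min r s) ^ p
      = (t : ℝ) ^ (p + q) / (p + q) := by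
    intro t hts
    have h1 := setIntegral_rpow (c := p + q - 1) (by linarith) t
    rw [sub_add_cancel] at h1
    rw [← h1]
    refine setIntegral_congr_fun measurableSet_Ioc fun r hr ↦ ?_
    rw [min_eq_left (hr.2.trans (NNReal.coe_le_coe.2 hts)), ← Real.rpow_add hr.1]
    congr 1
    ring
  rcases le_total t s with hts | hst
  · rw [hle t hts, min_eq_left (NNReal.coe_le_coe.2 hts), hadd _ t.coe_nonneg]
    field_simp
    ring
  have hst' : (s : ℝ) ≤ t := NNReal.coe_le_coe.2 hst
  rcases eq_or_ne s 0 with rfl | hs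
  · have : ∀ r ∈ Set.Ioc (0 : ℝ) t, r ^ (q - 1) * (min r ((0 : ℝ≥0) : ℝ)) ^ p = 0 := fun r hr ↦ by
      rw [NNReal.coe_zero, min_eq_right hr.1.le, Real.zero_rpow hp.ne', mul_zero]
    rw [setIntegral_eq_zero_of_forall_eq_zero this, min_eq_right hst', NNReal.coe_zero,
      Real.zero_rpow hp.ne', Real.zero_rpow hpq.ne']
    ring
  have hs0 : 0 < (s : ℝ) := by positivity
  have hint : ∀ r ∈ Set.Ioc (s : ℝ) t, r ^ (q - 1) * (min r s) ^ p = (s : ℝ) ^ p * r ^ (q - 1) :=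
    fun r hr ↦ by rw [min_eq_right hr.1.le, mul_comm]
  have h0 : (0 : ℝ) ∉ Set.uIcc (s : ℝ) t := by
    rw [Set.uIcc_of_le hst']
    exact fun h ↦ absurd h.1 (not_le.2 hs0)
  have i1 : IntegrableOn (fun r : ℝ ↦ r ^ (q - 1) * (min r s) ^ p) (Set.Ioc (0 : ℝ) s) := by
    refine IntegrableOn.congr_fun (integrableOn_rpow (c := p + q - 1) (by linarith) s)
      (fun r hr ↦ ?_) measurableSet_Ioc
    rw [min_eq_left hr.2, ← Real.rpow_add hr.1]
    congr 1
    ring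
  have i2 : IntegrableOn (fun r : ℝ ↦ r ^ (q - 1) * (min r s) ^ p) (Set.Ioc (s : ℝ) t) := by
    refine IntegrableOn.congr_fun ?_ (fun r hr ↦ (hint r hr).symm) measurableSet_Ioc
    exact ((intervalIntegrable_iff_integrableOn_Ioc_of_le hst').1
      (intervalIntegral.intervalIntegrable_rpow (Or.inr h0))).const_mul _
  have h2 : ∫ r in Set.Ioc (s : ℝ) t, r ^ (q - 1) * (min r s) ^ p
      = (s : ℝ) ^ p * (((t : ℝ) ^ q - (s : ℝ) ^ q) / q) := by
    rw [setIntegral_congr_fun measurableSet_Ioc hint, integral_const_mul,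
      ← intervalIntegral.integral_of_le hst', integral_rpow (Or.inr ⟨by
        intro h; exact hq (by linarith), h0⟩), sub_add_cancel]
  rw [← Set.Ioc_union_Ioc_eq_Ioc s.coe_nonneg hst', setIntegral_union
    (Set.Ioc_disjoint_Ioc_of_le le_rfl) measurableSet_Ioc i1 i2, hle s le_rfl, h2,
    min_eq_right hst', hadd _ s.coe_nonneg]
  field_simp
  ring

/-- A vector orthogonal to all values of the integrand is orthogonal to the integral, and the
closure is the double orthogonal complement. -/
theorem setIntegral_mem_topologicalClosure {E : Type*} [NormedAddCommGroup E]
    [InnerProductSpace ℝ E] [CompleteSpace E] (K : Submodule ℝ E) {f : ℝ → E} {A : Set ℝ}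
    (hf : IntegrableOn f A) (h : ∀ s ∈ A, f s ∈ K.topologicalClosure) :
    ∫ s in A, f s ∈ K.topologicalClosure := by
  rw [← Submodule.orthogonal_orthogonal_eq_closure, Submodule.mem_orthogonal]
  intro v hv
  rw [← integral_inner hf]
  refine setIntegral_eq_zero_of_forall_eq_zero fun s hs ↦ ?_
  have h1 := h s hs
  rw [← Submodule.orthogonal_orthogonal_eq_closure, Submodule.mem_orthogonal] at h1
  exact h1 v hv

section Family

variable {E : Type*} [NormedAddCommGroup E] [InnerProductSpace ℝ E]
  {m : ℝ≥0 → E} {c h : ℝ}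

theorem norm_of_inner_eq_min (hc : 0 ≤ c)
    (hm : ∀ s t, inner ℝ (m s) (m t) = c * (min (s : ℝ) t) ^ (2 - 2 * h)) (t : ℝ≥0) :
    ‖m t‖ = √c * (t : ℝ) ^ (1 - h) := by
  rw [← sq_eq_sq₀ (norm_nonneg _) (by positivity), ← real_inner_self_eq_norm_sq, hm, min_self,
    mul_pow, Real.sq_sqrt hc, ← Real.rpow_natCast, ← Real.rpow_mul t.coe_nonneg]
  congr 2
  push_cast
  ring

theorem continuous_of_inner_eq_min (h1 : h < 1)
    (hm : ∀ s t, inner ℝ (m s) (m t) = c * (min (s : ℝ) t) ^ (2 - 2 * h)) : Continuous m := by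
  rw [continuous_iff_continuousAt]
  intro t
  rw [ContinuousAt, tendsto_iff_norm_sub_tendsto_zero]
  have hcont : Continuous fun s : ℝ≥0 ↦ c * (s : ℝ) ^ (2 - 2 * h) - 2 * (c * (min (s : ℝ) t) ^ (2 - 2 * h))
      + c * (t : ℝ) ^ (2 - 2 * h) := by
    have h2 : ∀ {f : ℝ≥0 → ℝ}, Continuous f → Continuous fun s ↦ f s ^ (2 - 2 * h) := fun hf ↦
      hf.rpow_const fun _ ↦ Or.inr (by linarith)
    have h3 := h2 (f := fun s : ℝ≥0 ↦ (s : ℝ)) (by fun_prop)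
    have h4 := h2 (f := fun s : ℝ≥0 ↦ min (s : ℝ) t) (by fun_prop)
    fun_prop
  have h5 := (Real.continuous_sqrt.comp hcont).tendsto t
  simp only [Function.comp_apply, min_self] at h5
  rw [show c * (t : ℝ) ^ (2 - 2 * h) - 2 * (c * (t : ℝ) ^ (2 - 2 * h)) + c * (t : ℝ) ^ (2 - 2 * h)
    = 0 by ring, Real.sqrt_zero] at h5
  refine h5.congr fun s ↦ ?_
  rw [Function.comp_apply, ← Real.sqrt_sq (norm_nonneg (m s - m t)), norm_sub_sq_real, hm,
    ← real_inner_self_eq_norm_sq, ← real_inner_self_eq_norm_sq, hm, hm, min_self, min_self]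

/-- The norm of the integrand is `√c r^{h-3/2} r^{1-h} = √c r^{-1/2}`, integrable at zero for every
`h`. -/
theorem integrableOn_rpow_smul (hc : 0 ≤ c) (h1 : h < 1)
    (hm : ∀ s t, inner ℝ (m s) (m t) = c * (min (s : ℝ) t) ^ (2 - 2 * h)) (t : ℝ≥0) :
    IntegrableOn (fun r : ℝ ↦ r ^ (h - 1 / 2 - 1) • m r.toNNReal) (Set.Ioc (0 : ℝ) t) := by
  refine Integrable.mono' ((integrableOn_rpow (c := -1 / 2) (by norm_num) t).const_mul (√c)) ?_ ?_
  · refine ContinuousOn.aestronglyMeasurable ?_ measurableSet_Ioc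
    refine ContinuousOn.smul (fun r hr ↦ ?_)
      ((continuous_of_inner_eq_min h1 hm).comp continuous_real_toNNReal).continuousOn
    exact (Real.continuousAt_rpow_const _ _ (Or.inl hr.1.ne')).continuousWithinAt
  · rw [ae_restrict_iff' measurableSet_Ioc]
    refine ae_of_all _ fun r hr ↦ ?_
    rw [norm_smul, norm_of_inner_eq_min hc hm, Real.coe_toNNReal _ hr.1.le,
      Real.norm_of_nonneg (Real.rpow_nonneg hr.1.le _), mul_left_comm, ← Real.rpow_add hr.1]
    refine le_of_eq ?_
    congr 2
    ring

/-- The stochastic integral `∫_0^t s^{h-1/2} dm_s`, through integration by parts. -/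
def powIntegral (m : ℝ≥0 → E) (h : ℝ) (t : ℝ≥0) : E :=
  (t : ℝ) ^ (h - 1 / 2) • m t
    - (h - 1 / 2) • ∫ r in Set.Ioc (0 : ℝ) t, r ^ (h - 1 / 2 - 1) • m r.toNNReal

variable [CompleteSpace E]

/-- Pairing with `v` turns the integral into the scalar Stieltjes integral of `r^{h-1/2}` against `b
min(r, s)^p`, which `rpow_mul_min_sub_integral` evaluates. -/
theorem inner_powIntegral (hc : 0 ≤ c) (h1 : h < 1) (hh : h ≠ 1 / 2)
    (hm : ∀ s t, inner ℝ (m s) (m t) = c * (min (s : ℝ) t) ^ (2 - 2 * h)) {v : E} {s : ℝ≥0}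
    {b p : ℝ} (hp : 0 < p) (hph : 1 / 2 < p + h)
    (hv : ∀ r, inner ℝ v (m r) = b * (min (r : ℝ) s) ^ p) (t : ℝ≥0) :
    inner ℝ v (powIntegral m h t)
      = b * (p / (p + (h - 1 / 2)) * (min (t : ℝ) s) ^ (p + (h - 1 / 2))) := by
  have hint := integrableOn_rpow_smul hc h1 hm t
  have e : ∫ r in Set.Ioc (0 : ℝ) t, inner ℝ v (r ^ (h - 1 / 2 - 1) • m r.toNNReal)
      = b * ∫ r in Set.Ioc (0 : ℝ) t, r ^ (h - 1 / 2 - 1) * (min r s) ^ p := by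
    rw [← integral_const_mul]
    refine setIntegral_congr_fun measurableSet_Ioc fun r hr ↦ ?_
    rw [real_inner_smul_right, hv, Real.coe_toNNReal _ hr.1.le]
    ring
  rw [← rpow_mul_min_sub_integral hp (sub_ne_zero.2 hh) (by linarith) s t, powIntegral,
    inner_sub_right, real_inner_smul_right, real_inner_smul_right, ← integral_inner hint, hv, e]
  ring

theorem inner_left_powIntegral (hc : 0 ≤ c) (h1 : h < 1) (hh : h ≠ 1 / 2)
    (hm : ∀ s t, inner ℝ (m s) (m t) = c * (min (s : ℝ) t) ^ (2 - 2 * h)) (s t : ℝ≥0) :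
    inner ℝ (m s) (powIntegral m h t)
      = c * (2 - 2 * h) / (3 / 2 - h) * (min (t : ℝ) s) ^ (3 / 2 - h) := by
  rw [inner_powIntegral hc h1 hh hm (s := s) (b := c) (p := 2 - 2 * h) (by linarith) (by linarith)
    (fun r ↦ by rw [hm, min_comm]), show 2 - 2 * h + (h - 1 / 2) = 3 / 2 - h by ring]
  ring

/-- Each integration adds `h - 1/2` to the exponent. Applied in both arguments it takes `2 - 2h` to
`3/2 - h` and then to 1, the exponent of the Brownian covariance. -/
theorem inner_powIntegral_powIntegral (hc : 0 ≤ c) (h1 : h < 1) (hh : h ≠ 1 / 2)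
    (hm : ∀ s t, inner ℝ (m s) (m t) = c * (min (s : ℝ) t) ^ (2 - 2 * h)) (s t : ℝ≥0) :
    inner ℝ (powIntegral m h s) (powIntegral m h t) = c * (2 - 2 * h) * min (s : ℝ) t := by
  have h3 : (3 / 2 - h) ≠ 0 := by linarith
  rw [inner_powIntegral hc h1 hh hm (s := s) (b := c * (2 - 2 * h) / (3 / 2 - h)) (p := 3 / 2 - h)
    (by linarith) (by linarith)
    (fun r ↦ by rw [real_inner_comm, inner_left_powIntegral hc h1 hh hm, min_comm]),
    show 3 / 2 - h + (h - 1 / 2) = 1 by ring, Real.rpow_one, min_comm, div_one, ← mul_assoc,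
    div_mul_cancel₀ _ h3]

end Family

variable {P : Measure Ω}

theorem covariance_eq_inner [IsProbabilityMeasure P] {f g : Lp ℝ 2 P} (hf : ∫ ω, f ω ∂P = 0) :
    cov[f, g; P] = inner ℝ f g := by
  rw [covariance_eq_sub (Lp.memLp _) (Lp.memLp _), hf, zero_mul, sub_zero,
    inner_eq_integral_of_ae_eq (ae_eq_refl _) (ae_eq_refl _)]
  rfl

variable {Z : Hurst → ℝ≥0 → Ω → ℝ}

/-- The Brownian motion is `W_t = κ⁻¹ ∫_0^t s^{H-1/2} dM_s` with `κ² = c_M (2 - 2H)`. It is Gaussian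
and adapted because its values lie in the closed span of the past, and its covariance is computed by
`inner_powIntegral_powIntegral`. -/
theorem exists_driving [IsProbabilityMeasure P] (hZ : IsFractionalGaussianField Z P)
    {H : Hurst} (hH : (H : ℝ) ≠ 1 / 2) {M : ℝ≥0 → Ω → ℝ} (hM : IsProjectedMartingale Z P H M) :
    ∃ W : ℝ≥0 → Ω → ℝ, IsDrivingBrownianMotion Z P H M W := by
  obtain ⟨m, hmM, hmem, hm⟩ := exists_martingaleLp hZ hH hM
  have h0 : 0 < (H : ℝ) := H.2.1
  have h1 : (H : ℝ) < 1 := H.2.2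
  have hc := cM_pos H
  set κ := √(cM H * (2 - 2 * (H : ℝ))) with hκ
  have hκpos : 0 < κ := Real.sqrt_pos.2 (mul_pos hc (by linarith))
  have hκsq : κ * κ = cM H * (2 - 2 * (H : ℝ)) :=
    Real.mul_self_sqrt (mul_pos hc (by linarith)).le
  set w : ℝ≥0 → Lp ℝ 2 P := fun t ↦ κ⁻¹ • powIntegral m H t with hw
  have hwmem : ∀ t, w t ∈ pastSpan hZ H t := fun t ↦ by
    refine Submodule.smul_mem _ _ (Submodule.sub_mem _ (Submodule.smul_mem _ _ (hmem t))
      (Submodule.smul_mem _ _ (setIntegral_mem_topologicalClosure _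
        (integrableOn_rpow_smul hc.le h1 hm t) fun r hr ↦ Submodule.smul_mem _ _ ?_)))
    exact pastSpan_mono hZ H (Real.toNNReal_le_iff_le_coe.2 hr.2) (hmem _)
  have hB : ∀ s t, inner ℝ (w s) (w t) = ((min s t : ℝ≥0) : ℝ) := fun s t ↦ by
    rw [hw, real_inner_smul_left, real_inner_smul_right,
      inner_powIntegral_powIntegral hc.le h1 hH hm, ← hκsq, NNReal.coe_min]
    field_simp
  have hmw : ∀ t s : ℝ≥0, s ≤ t →
      inner ℝ (m t) (w s) = ∫ x in (0 : ℝ)..s, κ * x ^ (1 / 2 - (H : ℝ)) := fun t s hst ↦ by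
    have h3 : (3 / 2 - (H : ℝ)) ≠ 0 := by linarith
    rw [intervalIntegral.integral_of_le s.coe_nonneg, integral_const_mul,
      setIntegral_rpow (by linarith), hw, real_inner_smul_right,
      inner_left_powIntegral hc.le h1 hH hm, ← hκsq, min_eq_left (NNReal.coe_le_coe.2 hst),
      show 1 / 2 - (H : ℝ) + 1 = 3 / 2 - H by ring]
    field_simp
  have hgauss : ∀ f ∈ gaussianSpan hZ, IsCenteredGaussian f := fun f hf ↦
    isCenteredGaussian_of_mem_gaussianSpan hZ hf
  have hwS : ∀ t, w t ∈ gaussianSpan hZ := fun t ↦ pastSpan_le_gaussianSpan hZ H t (hwmem t)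
  refine ⟨fun t ↦ w t, ?_, fun t ↦ aestronglyMeasurable_of_mem_pastSpan hZ (hwmem t), fun t ↦ ?_⟩
  · refine IsGaussianProcess.isPreBrownianReal_of_covariance
      (isGaussianProcess_of_mem hgauss fun t ↦ ⟨w t, hwS t, ae_eq_refl _⟩)
      (fun t ↦ (hgauss _ (hwS t)).integral_eq_zero) fun s t hst ↦ ?_
    rw [covariance_eq_inner (hgauss _ (hwS s)).integral_eq_zero, hB, min_eq_left hst]
  · have hf : MemLp (fun s : ℝ ↦ s ^ (1 / 2 - (H : ℝ))) 2 (volume.restrict (Set.Ioc (0 : ℝ) t)) :=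
      memLp_rpow (by linarith) t
    have hI := isWienerIntegral_wienerIntegral (W := fun t ↦ (w t : Ω → ℝ)) hB
      (fun t ↦ ae_eq_refl _) hf
    set x : Lp ℝ 2 P := hI.memLp.toLp with hx
    have hxI := hI.memLp.coeFn_toLp
    have hsq : ∫ u in Set.Ioc (0 : ℝ) t, u ^ (1 / 2 - (H : ℝ)) * u ^ (1 / 2 - (H : ℝ))
        = (t : ℝ) ^ (2 - 2 * (H : ℝ)) / (2 - 2 * (H : ℝ)) := by
      have h3 := setIntegral_rpow (c := 1 - 2 * (H : ℝ)) (by linarith) t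
      rw [show 1 - 2 * (H : ℝ) + 1 = 2 - 2 * H by ring] at h3
      rw [← h3]
      refine setIntegral_congr_fun measurableSet_Ioc fun u hu ↦ ?_
      rw [← Real.rpow_add hu.1]
      congr 1
      ring
    have hxx : inner ℝ x x = (t : ℝ) ^ (2 - 2 * (H : ℝ)) / (2 - 2 * (H : ℝ)) := by
      rw [hI.inner_inner hB hI (fun t ↦ ae_eq_refl _) hxI hxI hf hf, min_self, hsq]
    have hmx : inner ℝ (m t) x = κ * ((t : ℝ) ^ (2 - 2 * (H : ℝ)) / (2 - 2 * (H : ℝ))) := by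
      rw [hI.inner_eq (fun t ↦ ae_eq_refl _) hxI hf (hf.const_mul κ) (hmw t), ← hsq,
        ← integral_const_mul]
      exact integral_congr_ae (ae_of_all _ fun u ↦ mul_assoc _ _ _)
    -- Three inner products suffice: `‖m t‖²`, `⟪m t, x⟫` and `‖x‖²` are `κ²`, `κ` and `1` times the
    -- same number, so `‖m t - κ x‖² = 0`.
    have hdiff : m t = κ • x := by
      have h2 : 2 - 2 * (H : ℝ) ≠ 0 := by linarith
      rw [← sub_eq_zero, ← inner_self_eq_zero (𝕜 := ℝ), inner_sub_left, inner_sub_right,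
        inner_sub_right, real_inner_smul_left, real_inner_smul_right, real_inner_smul_left,
        real_inner_smul_right, hxx, real_inner_comm (m t) x, hmx, hm, min_self]
      have : cM H = κ * κ / (2 - 2 * (H : ℝ)) := (eq_div_iff h2).2 hκsq.symm
      rw [this]
      ring
    have h4 := hmM t
    rw [hdiff] at h4
    filter_upwards [h4, Lp.coeFn_smul κ x, hxI] with ω e1 e2 e3
    rw [← e1, e2, Pi.smul_apply, e3, smul_eq_mul]

end Driving

/-! ### Pathwise integrals as Bochner integrals -/

section Fubini

variable {P : Measure Ω} {M : ℝ≥0 → Ω → ℝ} {m : ℝ≥0 → Lp ℝ 2 P}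

/-- A process with almost surely continuous paths is indistinguishable from a jointly measurable
one. -/
theorem exists_measurable_uncurry (hm : ∀ t, m t =ᵐ[P] M t)
    (hM : ∀ᵐ ω ∂P, Continuous fun t ↦ M t ω) :
    ∃ N : ℝ≥0 → Ω → ℝ, Measurable (Function.uncurry N) ∧ ∀ᵐ ω ∂P, ∀ t, N t ω = M t ω := by
  classical
  set q := TopologicalSpace.denseSeq ℝ≥0 with hq
  have hgood : ∀ᵐ ω ∂P, (Continuous fun t ↦ M t ω) ∧ ∀ n, m (q n) ω = M (q n) ω :=
    hM.and (ae_all_iff.2 fun n ↦ hm (q n))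
  -- Each `M t` is only known to agree almost everywhere with a measurable function. Off the
  -- measurable null set `S`, paths are continuous and agree with measurable representatives at
  -- countably many dense times. This makes `N` measurable at those times, and by continuity at all
  -- times.
  set S := toMeasurable P {ω | ¬ ((Continuous fun t ↦ M t ω) ∧ ∀ n, m (q n) ω = M (q n) ω)} with hS
  have hS0 : P S = 0 := by rw [hS, measure_toMeasurable]; exact hgood
  have hSm : MeasurableSet S := measurableSet_toMeasurable _ _
  have hSc : ∀ ω ∉ S, (Continuous fun t ↦ M t ω) ∧ ∀ n, m (q n) ω = M (q n) ω := fun ω hω ↦ by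
    by_contra h
    exact hω (subset_toMeasurable _ _ h)
  set N : ℝ≥0 → Ω → ℝ := fun t ↦ Sᶜ.indicator (M t) with hN
  have hcont : ∀ ω, Continuous fun t ↦ N t ω := fun ω ↦ by
    by_cases hω : ω ∈ S
    · have : (fun t ↦ N t ω) = fun _ ↦ 0 := by
        ext t
        exact Set.indicator_of_notMem (Set.notMem_compl_iff.2 hω) _
      rw [this]
      exact continuous_const
    · have : (fun t ↦ N t ω) = fun t ↦ M t ω := by
        ext t
        exact Set.indicator_of_mem hω _
      rw [this]
      exact (hSc ω hω).1
  have hmeasq : ∀ n, Measurable (N (q n)) := fun n ↦ by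
    have : N (q n) = Sᶜ.indicator (m (q n)) :=
      Set.indicator_congr fun ω hω ↦ ((hSc ω hω).2 n).symm
    rw [this]
    exact (Lp.stronglyMeasurable _).measurable.indicator hSm.compl
  have hmeas : ∀ t, Measurable (N t) := fun t ↦ by
    obtain ⟨u, hu, hut⟩ := mem_closure_iff_seq_limit.1
      (TopologicalSpace.denseRange_denseSeq ℝ≥0 t)
    choose k hk using hu
    refine measurable_of_tendsto_metrizable (f := fun n ↦ N (u n)) (fun n ↦ ?_)
      (tendsto_pi_nhds.2 fun ω ↦ ((hcont ω).tendsto t).comp hut)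
    rw [← hk n]
    exact hmeasq _
  refine ⟨N, measurable_uncurry_of_continuous_of_measurable hcont hmeas, ?_⟩
  filter_upwards [measure_eq_zero_iff_ae_notMem.1 hS0] with ω hω t
  exact Set.indicator_of_mem hω _

/-- The Bochner integral of a family of `L²` vectors is the pathwise integral of the process. -/
theorem coeFn_setIntegral_smul [IsProbabilityMeasure P] (hm : ∀ t, m t =ᵐ[P] M t)
    (hM : ∀ᵐ ω ∂P, Continuous fun t ↦ M t ω) (hmc : Continuous m) {φ : ℝ → ℝ} {a b : ℝ}
    (hφ : ContinuousOn φ (Set.Icc a b)) :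
    (∫ s in Set.Ioc a b, φ s • m s.toNNReal : Lp ℝ 2 P)
      =ᵐ[P] fun ω ↦ ∫ s in Set.Ioc a b, φ s * M s.toNNReal ω := by
  obtain ⟨N, hNm, hNM⟩ := exists_measurable_uncurry hm hM
  set ν := (volume : Measure ℝ).restrict (Set.Ioc a b) with hν
  have hmN : ∀ t, m t =ᵐ[P] N t := fun t ↦ by
    filter_upwards [hm t, hNM] with ω h1 h2
    rw [h1, h2]
  have hint : Integrable (fun s ↦ φ s • m s.toNNReal) ν :=
    ((hφ.smul (hmc.comp continuous_real_toNNReal).continuousOn).integrableOn_Icc).mono_set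
      Set.Ioc_subset_Icc_self
  have hφm : AEStronglyMeasurable φ ν :=
    (hφ.mono Set.Ioc_subset_Icc_self).aestronglyMeasurable measurableSet_Ioc
  set F : Ω → ℝ → ℝ := fun ω s ↦ φ s * N s.toNNReal ω with hF
  have hFm : AEStronglyMeasurable (Function.uncurry F) (P.prod ν) := by
    refine (hφm.comp_snd (μ := P)).mul (Measurable.aestronglyMeasurable ?_)
    exact hNm.comp ((measurable_real_toNNReal.comp measurable_snd).prodMk measurable_fst)
  have hNint : ∀ t, Integrable (N t) P := fun t ↦
    ((Lp.memLp (m t)).integrable one_le_two).congr (hmN t)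
  have hFint : Integrable (Function.uncurry F) (P.prod ν) := by
    refine (integrable_prod_iff' hFm).2 ⟨ae_of_all _ fun s ↦ ?_, ?_⟩
    · exact (hNint s.toNNReal).const_mul (φ s)
    -- On a probability space `∫ |m s| ≤ ‖m s‖`, so Bochner integrability in `L²` gives
    -- integrability on the product.
    refine hint.norm.mono' hFm.prod_swap.norm.integral_prod_right' (ae_of_all _ fun s ↦ ?_)
    have h1 : ∫ ω, ‖Function.uncurry F (ω, s)‖ ∂P = |φ s| * ∫ ω, |m s.toNNReal ω| ∂P := by
      rw [← integral_const_mul]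
      refine integral_congr_ae ?_
      filter_upwards [hmN s.toNNReal] with ω h
      rw [h, Function.uncurry_apply_pair, hF, Real.norm_eq_abs, abs_mul]
    rw [h1, Real.norm_of_nonneg (mul_nonneg (abs_nonneg _) (integral_nonneg fun _ ↦ abs_nonneg _)),
      norm_smul, Real.norm_eq_abs]
    exact mul_le_mul_of_nonneg_left (integral_norm_le_norm _) (abs_nonneg _)
  -- Both sides are tested on a measurable set `B`. On the left, integration over `B` is the inner
  -- product with an indicator and passes through the Bochner integral; on the right, Fubini
  -- applies.
  have key : (∫ s, φ s • m s.toNNReal ∂ν : Lp ℝ 2 P) =ᵐ[P] fun ω ↦ ∫ s, F ω s ∂ν := by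
    refine Integrable.ae_eq_of_forall_setIntegral_eq _ _
      ((Lp.memLp _).integrable one_le_two) hFint.integral_prod_left fun B hB hPB ↦ ?_
    have hrestr : Integrable (Function.uncurry F) ((P.restrict B).prod ν) := by
      have := hFint.restrict (s := B ×ˢ Set.univ)
      rwa [← Measure.prod_restrict, Measure.restrict_univ] at this
    rw [integral_integral_swap hrestr, ← L2.inner_indicatorConstLp_one hB hPB.ne,
      ← integral_inner hint]
    refine integral_congr_ae (ae_of_all _ fun s ↦ ?_)
    change inner ℝ _ (φ s • m s.toNNReal) = ∫ ω in B, φ s * N s.toNNReal ω ∂P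
    rw [real_inner_smul_right, L2.inner_indicatorConstLp_one hB hPB.ne, integral_const_mul,
      integral_congr_ae (ae_restrict_of_ae (hmN _))]
  filter_upwards [key, hNM] with ω h1 h2
  rw [h1]
  exact integral_congr_ae (ae_of_all _ fun s ↦ by rw [hF]; beta_reduce; rw [h2])

end Fubini

/-! ### The double integral in the variance of the drift -/

section Covariance

variable {a b s h : ℝ}

theorem integrableOn_Ioc_rpow (ha : 0 < a) (c : ℝ) :
    IntegrableOn (fun u : ℝ ↦ u ^ c) (Set.Ioc a b) :=
  (ContinuousOn.integrableOn_Icc fun _ hu ↦ (Real.continuousAt_rpow_const _ _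
    (Or.inl (ha.trans_le hu.1).ne')).continuousWithinAt).mono_set Set.Ioc_subset_Icc_self

theorem setIntegral_Ioc_rpow (ha : 0 < a) (hab : a ≤ b) {c : ℝ} (hc : c ≠ -1) :
    ∫ u in Set.Ioc a b, u ^ c = (b ^ (c + 1) - a ^ (c + 1)) / (c + 1) := by
  rw [← intervalIntegral.integral_of_le hab, integral_rpow (Or.inr ⟨hc, ?_⟩)]
  rw [Set.uIcc_of_le hab]
  exact fun h ↦ absurd h.1 (not_le.2 ha)

theorem setIntegral_rpow_mul_min (ha : 0 < a) (hs : s ∈ Set.Ioc a b) (hh : h ≠ 1 / 2) :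
    ∫ u in Set.Ioc a b, u ^ (2 * h - 2) * (min u s) ^ (2 - 2 * h)
      = (s - a) + s ^ (2 - 2 * h) * ((b ^ (2 * h - 1) - s ^ (2 * h - 1)) / (2 * h - 1)) := by
  have hs0 : 0 < s := ha.trans hs.1
  have e1 : ∀ u ∈ Set.Ioc a s, u ^ (2 * h - 2) * (min u s) ^ (2 - 2 * h) = 1 := fun u hu ↦ by
    rw [min_eq_left hu.2, ← Real.rpow_add (ha.trans hu.1)]
    ring_nf
    exact Real.rpow_zero u
  have e2 : ∀ u ∈ Set.Ioc s b, u ^ (2 * h - 2) * (min u s) ^ (2 - 2 * h)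
      = s ^ (2 - 2 * h) * u ^ (2 * h - 2) := fun u hu ↦ by
    rw [min_eq_right hu.1.le, mul_comm]
  have i1 : IntegrableOn (fun u : ℝ ↦ u ^ (2 * h - 2) * (min u s) ^ (2 - 2 * h)) (Set.Ioc a s) :=
    (integrableOn_const (by simp)).congr_fun (fun u hu ↦ (e1 u hu).symm) measurableSet_Ioc
  have i2 : IntegrableOn (fun u : ℝ ↦ u ^ (2 * h - 2) * (min u s) ^ (2 - 2 * h)) (Set.Ioc s b) :=
    IntegrableOn.congr_fun ((integrableOn_Ioc_rpow hs0 _).const_mul _)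
      (fun u hu ↦ (e2 u hu).symm) measurableSet_Ioc
  have hc : 2 * h - 2 ≠ -1 := fun h' ↦ hh (by linarith)
  rw [← Set.Ioc_union_Ioc_eq_Ioc hs.1.le hs.2, setIntegral_union
    (Set.Ioc_disjoint_Ioc_of_le le_rfl) measurableSet_Ioc i1 i2,
    setIntegral_congr_fun measurableSet_Ioc e1, setIntegral_congr_fun measurableSet_Ioc e2,
    integral_const_mul, setIntegral_Ioc_rpow hs0 hs.2 hc, show 2 * h - 2 + 1 = 2 * h - 1 by ring]
  simp [Real.volume_real_Ioc_of_le hs.1.le]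

/-- Up to the constants `c_M` and `c_Ψ² (2h-1)²` this is the second moment of the drift. The weight
`s^{2h-2}` cancels the power of the variance, so the inner integral leaves a combination of
`s^{2h-1}`, `s^{2h-2}` and a constant. -/
theorem setIntegral_setIntegral_min (ha : 0 < a) (hab : a ≤ b) (h0 : 0 < h) (hh : h ≠ 1 / 2) :
    ∫ s in Set.Ioc a b, s ^ (2 * h - 2)
        * ∫ u in Set.Ioc a b, u ^ (2 * h - 2) * (min u s) ^ (2 - 2 * h)
      = 2 * (1 / (2 * h) * (b ^ (2 * h) - a ^ (2 * h))
        - a / (2 * h - 1) * (b ^ (2 * h - 1) - a ^ (2 * h - 1))) := by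
  have hq : 2 * h - 1 ≠ 0 := fun h' ↦ hh (by linarith)
  have hb : 0 < b := ha.trans_le hab
  have hp : ∀ x : ℝ, 0 < x → x ^ (2 * h) = x * x ^ (2 * h - 1) := fun x hx ↦ by
    rw [Real.rpow_sub_one hx.ne', mul_div_cancel₀ _ hx.ne']
  have hp1 : ∀ x : ℝ, 0 < x → x ^ (2 * h - 1) = x * x ^ (2 * h - 2) := fun x hx ↦ by
    rw [show 2 * h - 2 = 2 * h - 1 - 1 by ring, Real.rpow_sub_one hx.ne' (2 * h - 1),
      mul_div_cancel₀ _ hx.ne']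
  have e : ∀ s ∈ Set.Ioc a b, s ^ (2 * h - 2)
        * ∫ u in Set.Ioc a b, u ^ (2 * h - 2) * (min u s) ^ (2 - 2 * h)
      = ((1 - 1 / (2 * h - 1)) * s ^ (2 * h - 1) + -a * s ^ (2 * h - 2))
        + b ^ (2 * h - 1) / (2 * h - 1) := fun s hs ↦ by
    have hs0 : 0 < s := ha.trans hs.1
    have h2 : s ^ (2 * h - 2) * s ^ (2 - 2 * h) = 1 := by
      rw [← Real.rpow_add hs0]
      ring_nf
      exact Real.rpow_zero s
    rw [setIntegral_rpow_mul_min ha hs hh, mul_add, ← mul_assoc, h2, hp1 s hs0]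
    ring
  have i1 := (integrableOn_Ioc_rpow (b := b) ha (2 * h - 1)).const_mul (1 - 1 / (2 * h - 1))
  have i2 := (integrableOn_Ioc_rpow (b := b) ha (2 * h - 2)).const_mul (-a)
  have i12 : IntegrableOn (fun s : ℝ ↦ (1 - 1 / (2 * h - 1)) * s ^ (2 * h - 1)
      + -a * s ^ (2 * h - 2)) (Set.Ioc a b) := i1.add i2
  have i3 : IntegrableOn (fun _ : ℝ ↦ b ^ (2 * h - 1) / (2 * h - 1)) (Set.Ioc a b) :=
    integrableOn_const (by simp)
  rw [setIntegral_congr_fun measurableSet_Ioc e, integral_add i12 i3, integral_add i1 i2,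
    integral_const_mul, integral_const_mul, setIntegral_Ioc_rpow ha hab (by linarith),
    setIntegral_Ioc_rpow ha hab fun h' ↦ hq (by linarith), setIntegral_const,
    Real.volume_real_Ioc_of_le hab, sub_add_cancel, show 2 * h - 2 + 1 = 2 * h - 1 by ring,
    smul_eq_mul, hp a ha, hp b hb]
  field_simp
  ring

end Covariance

/-! ### Moments of the modified process -/

section Moments

theorem setIntegral_indicator_Ici (g : ℝ → ℝ) {ε : ℝ} (hε : 0 < ε) (t : ℝ) :
    ∫ s in Set.Ioc 0 t, (Set.Ici ε).indicator g s = ∫ s in Set.Ioc ε t, g s := by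
  have : Set.Ioc 0 t ∩ Set.Ici ε = Set.Icc ε t := by
    ext x
    constructor
    · exact fun hx ↦ ⟨hx.2, hx.1.2⟩
    · exact fun hx ↦ ⟨⟨hε.trans_le hx.1, hx.2⟩, hx.1⟩
  rw [setIntegral_indicator measurableSet_Ici, this, integral_Icc_eq_integral_Ioc]

variable {P : Measure Ω} [IsProbabilityMeasure P] {Z : Hurst → ℝ≥0 → Ω → ℝ} {H : Hurst}
  {M W : ℝ≥0 → Ω → ℝ}

/-- Translation of the process into `L²` for an arbitrary driving `W`. Joint Gaussianity of `W` with
the field is not needed: means and inner products suffice, and the driving equation supplies the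
pairing of `y` with the martingale. -/
theorem exists_modifiedProcessLp (hZ : IsFractionalGaussianField Z P) (hH : (H : ℝ) ≠ 1 / 2)
    (hM : IsProjectedMartingale Z P H M) (hW : IsDrivingBrownianMotion Z P H M W) {ε : ℝ}
    (hε : 0 < ε) (t : ℝ≥0) :
    ∃ (m : ℝ≥0 → Lp ℝ 2 P) (y : Lp ℝ 2 P), Continuous m ∧ (∀ s, ∫ ω, m s ω ∂P = 0) ∧
      (∀ r s, inner ℝ (m r) (m s) = cM H * (min (r : ℝ) s) ^ (2 - 2 * (H : ℝ))) ∧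
      ∫ ω, y ω ∂P = 0 ∧ inner ℝ y y = (t : ℝ) ^ (2 * (H : ℝ)) / (2 * H) ∧
      (∀ s ≤ t, inner ℝ y (m s) = √(cM H * (2 - 2 * (H : ℝ))) * s) ∧
      (diffusionConst H • y + ∫ s in Set.Ioc ε t,
        (cPsi H * (2 * (H : ℝ) - 1) * s ^ (2 * (H : ℝ) - 2)) • m s.toNNReal : Lp ℝ 2 P)
        =ᵐ[P] modifiedProcess P H M W ε t := by
  obtain ⟨m, hmM, hmem, hm⟩ := exists_martingaleLp hZ hH hM
  have h0 : 0 < (H : ℝ) := H.2.1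
  have h1 : (H : ℝ) < 1 := H.2.2
  have hmc := continuous_of_inner_eq_min h1 hm
  have hWL : ∀ s, MemLp (W s) 2 P := fun s ↦
    (hW.brownian.isGaussianProcess.hasGaussianLaw_eval s).memLp_two
  set w : ℝ≥0 → Lp ℝ 2 P := fun s ↦ (hWL s).toLp with hwdef
  have hw : ∀ s, w s =ᵐ[P] W s := fun s ↦ (hWL s).coeFn_toLp
  have hB : ∀ r s, inner ℝ (w r) (w s) = ((min r s : ℝ≥0) : ℝ) := fun r s ↦ by
    have h2 := hW.brownian.covariance_eval r s
    rw [covariance_eq_sub (hWL r) (hWL s), hW.brownian.integral_eval r, zero_mul, sub_zero] at h2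
    rw [inner_eq_integral_of_ae_eq (hw r) (hw s), ← h2]
    rfl
  have hf : ∀ s : ℝ≥0, MemLp (fun u : ℝ ↦ u ^ (1 / 2 - (H : ℝ))) 2
      (volume.restrict (Set.Ioc (0 : ℝ) s)) := fun s ↦ memLp_rpow (by linarith) s
  have hg : MemLp (fun u : ℝ ↦ u ^ ((H : ℝ) - 1 / 2)) 2
      (volume.restrict (Set.Ioc (0 : ℝ) t)) := memLp_rpow (by linarith) t
  have hI := fun s ↦ isWienerIntegral_wienerIntegral hB hw (hf s)
  have hJ := isWienerIntegral_wienerIntegral hB hw hg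
  set y : Lp ℝ 2 P := hJ.memLp.toLp with hy
  have hyJ := hJ.memLp.coeFn_toLp
  refine ⟨m, y, hmc, fun s ↦ ?_, hm, ?_, ?_, fun s hst ↦ ?_, ?_⟩
  · exact (isCenteredGaussian_of_mem_gaussianSpan hZ
      (pastSpan_le_gaussianSpan hZ H s (hmem s))).integral_eq_zero
  · rw [integral_congr_ae hyJ]
    exact hJ.integral_eq_zero hw hyJ hg hW.brownian.integral_eval
  · have h2 := setIntegral_rpow (c := 2 * (H : ℝ) - 1) (by linarith) t
    rw [sub_add_cancel] at h2
    rw [hJ.inner_inner hB hJ hw hyJ hyJ hg hg, min_self, ← h2]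
    refine setIntegral_congr_fun measurableSet_Ioc fun u hu ↦ ?_
    rw [← Real.rpow_add hu.1]
    congr 1
    ring
  · have hxI := (hI s).memLp.coeFn_toLp
    have hms : m s = √(cM H * (2 - 2 * (H : ℝ))) • (hI s).memLp.toLp := by
      refine Lp.ext ?_
      filter_upwards [hmM s, hW.drives s, Lp.coeFn_smul (√(cM H * (2 - 2 * (H : ℝ))))
        (hI s).memLp.toLp, hxI] with ω e1 e2 e3 e4
      rw [e1, e2, e3, Pi.smul_apply, e4, smul_eq_mul]
    -- The integrands of the diffusion part and of the martingale are reciprocal, so their Itô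
    -- pairing is the length of the interval.
    have h2 : ∀ u ∈ Set.Ioc (0 : ℝ) s, u ^ ((H : ℝ) - 1 / 2) * u ^ (1 / 2 - (H : ℝ)) = 1 :=
      fun u hu ↦ by
        rw [← Real.rpow_add hu.1]
        ring_nf
        exact Real.rpow_zero u
    rw [hms, real_inner_smul_right, hJ.inner_inner hB (hI s) hw hyJ hxI hg (hf s),
      min_eq_right (NNReal.coe_le_coe.2 hst), setIntegral_congr_fun measurableSet_Ioc h2]
    simp
  · have hφ : ContinuousOn (fun s : ℝ ↦ cPsi H * (2 * (H : ℝ) - 1) * s ^ (2 * (H : ℝ) - 2))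
        (Set.Icc ε t) := fun u hu ↦ ContinuousAt.continuousWithinAt
      ((Real.continuousAt_rpow_const _ _ (Or.inl (hε.trans_le hu.1).ne')).const_mul _)
    filter_upwards [Lp.coeFn_add (diffusionConst H • y) (∫ s in Set.Ioc ε t,
        (cPsi H * (2 * (H : ℝ) - 1) * s ^ (2 * (H : ℝ) - 2)) • m s.toNNReal),
      Lp.coeFn_smul (diffusionConst H) y, hyJ,
      coeFn_setIntegral_smul hmM hM.continuous_paths hmc hφ] with ω e1 e2 e3 e4
    rw [e1, Pi.add_apply, e2, Pi.smul_apply, e3, e4, modifiedProcess,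
      setIntegral_indicator_Ici _ hε, smul_eq_mul]

/-- The second moment is the squared norm of `C y + d`, where `d` is the drift vector. For `t ≤ ε`
the drift vanishes; for `t > ε` the three terms of the formula are the square of the diffusion part,
the cross term and the square of the drift. -/
theorem moments_modifiedProcess (hZ : IsFractionalGaussianField Z P) (hH : (H : ℝ) ≠ 1 / 2)
    (hM : IsProjectedMartingale Z P H M) (hW : IsDrivingBrownianMotion Z P H M W) {ε : ℝ}
    (hε : 0 < ε) (t : ℝ≥0) :
    MemLp (modifiedProcess P H M W ε t) 2 P ∧ ∫ ω, modifiedProcess P H M W ε t ω ∂P = 0 ∧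
      ((t : ℝ) ≤ ε → ∫ ω, modifiedProcess P H M W ε t ω ^ 2 ∂P =
        diffusionConst H ^ 2 * (t : ℝ) ^ (2 * (H : ℝ)) / (2 * (H : ℝ))) ∧
      (ε < (t : ℝ) → ∫ ω, modifiedProcess P H M W ε t ω ^ 2 ∂P =
        diffusionConst H ^ 2 / (2 * (H : ℝ)) * (t : ℝ) ^ (2 * (H : ℝ))
        + 2 * diffusionConst H ^ 2 * (2 * (H : ℝ) - 1) * (1 / (2 * (H : ℝ)))
            * ((t : ℝ) ^ (2 * (H : ℝ)) - ε ^ (2 * (H : ℝ)))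
        + 2 * cM H * cPsi H ^ 2 * (2 * (H : ℝ) - 1) ^ 2
            * (1 / (2 * (H : ℝ)) * ((t : ℝ) ^ (2 * (H : ℝ)) - ε ^ (2 * (H : ℝ)))
              - ε / (2 * (H : ℝ) - 1)
                * ((t : ℝ) ^ (2 * (H : ℝ) - 1) - ε ^ (2 * (H : ℝ) - 1)))) := by
  obtain ⟨m, y, hmc, hm0, hm, hy0, hyy, hym, hV⟩ := exists_modifiedProcessLp hZ hH hM hW hε t
  have h0 : 0 < (H : ℝ) := H.2.1
  set b := cPsi H * (2 * (H : ℝ) - 1) with hb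
  have hint : IntegrableOn (fun s : ℝ ↦ (b * s ^ (2 * (H : ℝ) - 2)) • m s.toNNReal)
      (Set.Ioc ε t) := by
    have hφ : ContinuousOn (fun s : ℝ ↦ b * s ^ (2 * (H : ℝ) - 2)) (Set.Icc ε t) := fun u hu ↦
      ContinuousAt.continuousWithinAt
        ((Real.continuousAt_rpow_const _ _ (Or.inl (hε.trans_le hu.1).ne')).const_mul _)
    exact ((hφ.smul (hmc.comp continuous_real_toNNReal).continuousOn).integrableOn_Icc).mono_set
      Set.Ioc_subset_Icc_self
  set d : Lp ℝ 2 P := ∫ s in Set.Ioc ε t, (b * s ^ (2 * (H : ℝ) - 2)) • m s.toNNReal with hd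
  have hinner : ∀ v : Lp ℝ 2 P, inner ℝ v d
      = ∫ s in Set.Ioc ε t, b * (s ^ (2 * (H : ℝ) - 2) * inner ℝ v (m s.toNNReal)) := fun v ↦ by
    rw [hd, ← integral_inner hint]
    refine integral_congr_ae (ae_of_all _ fun s ↦ ?_)
    beta_reduce
    rw [real_inner_smul_right, mul_assoc]
  set v : Lp ℝ 2 P := diffusionConst H • y + d with hv
  have hsq : ∫ ω, modifiedProcess P H M W ε t ω ^ 2 ∂P = diffusionConst H ^ 2 * inner ℝ y y
      + 2 * diffusionConst H * inner ℝ y d + inner ℝ d d := by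
    have h2 := inner_eq_integral_of_ae_eq hV hV
    simp only [← pow_two] at h2
    rw [← h2, hv, inner_add_left, inner_add_right, inner_add_right, real_inner_smul_left,
      real_inner_smul_right, real_inner_smul_left, real_inner_smul_right, real_inner_comm y d]
    ring
  refine ⟨(memLp_congr_ae hV).1 (Lp.memLp v), ?_, fun ht ↦ ?_, fun ht ↦ ?_⟩
  · set one : Lp ℝ 2 P := (memLp_const (1 : ℝ)).toLp with hone
    have h1 : ∀ {z : Lp ℝ 2 P} {Y : Ω → ℝ}, z =ᵐ[P] Y → inner ℝ one z = ∫ ω, Y ω ∂P :=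
      fun hz ↦ by
        rw [inner_eq_integral_of_ae_eq (MemLp.coeFn_toLp _) hz]
        simp
    rw [← h1 hV, hv, inner_add_right, real_inner_smul_right, h1 (ae_eq_refl y), hy0, hinner]
    simp only [h1 (ae_eq_refl (m _)), hm0, mul_zero, integral_zero, add_zero]
  · have hd0 : d = 0 := by rw [hd, Set.Ioc_eq_empty (not_lt.2 ht), setIntegral_empty]
    rw [hsq, hd0, inner_zero_right, inner_zero_right, hyy]
    ring
  · have hyd : inner ℝ y d = b * √(cM H * (2 - 2 * (H : ℝ)))
        * (((t : ℝ) ^ (2 * (H : ℝ)) - ε ^ (2 * (H : ℝ))) / (2 * H)) := by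
      have h2 := setIntegral_Ioc_rpow hε ht.le (c := 2 * (H : ℝ) - 1) (by linarith)
      rw [sub_add_cancel] at h2
      rw [hinner, ← h2, ← integral_const_mul]
      refine setIntegral_congr_fun measurableSet_Ioc fun s hs ↦ ?_
      have hs0 : 0 < s := hε.trans hs.1
      rw [hym _ (Real.toNNReal_le_iff_le_coe.2 hs.2), Real.coe_toNNReal _ hs0.le,
        show 2 * (H : ℝ) - 1 = 2 * H - 2 + 1 by ring, Real.rpow_add_one hs0.ne']
      ring
    have hmd : ∀ s ∈ Set.Ioc ε (t : ℝ), inner ℝ d (m s.toNNReal) = b * cM H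
        * ∫ u in Set.Ioc ε t, u ^ (2 * (H : ℝ) - 2) * (min u s) ^ (2 - 2 * (H : ℝ)) :=
      fun s hs ↦ by
        rw [real_inner_comm, hinner, ← integral_const_mul]
        refine setIntegral_congr_fun measurableSet_Ioc fun u hu ↦ ?_
        rw [hm, Real.coe_toNNReal _ (hε.trans hs.1).le, Real.coe_toNNReal _ (hε.trans hu.1).le,
          min_comm]
        ring
    have hdd : inner ℝ d d = b ^ 2 * cM H * (2 * (1 / (2 * (H : ℝ))
        * ((t : ℝ) ^ (2 * (H : ℝ)) - ε ^ (2 * (H : ℝ))) - ε / (2 * (H : ℝ) - 1)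
          * ((t : ℝ) ^ (2 * (H : ℝ) - 1) - ε ^ (2 * (H : ℝ) - 1)))) := by
      rw [hinner, ← setIntegral_setIntegral_min hε ht.le h0 hH, ← integral_const_mul]
      refine setIntegral_congr_fun measurableSet_Ioc fun s hs ↦ ?_
      rw [hmd s hs]
      ring
    -- The cross term contains `c_Ψ √(c_M (2 - 2H)) = C`, which turns `2C` into `2C²`. The square
    -- root occurs to the same power on both sides and need not be evaluated.
    rw [hsq, hyy, hyd, hdd, diffusionConst, hb]
    ring

end Moments

end DobricOjeda

end

theorem mainTheorem11 {Ω : Type*} [MeasurableSpace Ω] (P : Measure Ω) [IsProbabilityMeasure P]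
    (Z : DobricOjeda.Hurst → ℝ≥0 → Ω → ℝ)
    (hZ : DobricOjeda.IsFractionalGaussianField Z P)
    (H : DobricOjeda.Hurst) (hH : (H : ℝ) ≠ 1 / 2)
    (M : ℝ≥0 → Ω → ℝ) (hM : DobricOjeda.IsProjectedMartingale Z P H M) :
    (∃ W : ℝ≥0 → Ω → ℝ, DobricOjeda.IsDrivingBrownianMotion Z P H M W) ∧
    ∀ W : ℝ≥0 → Ω → ℝ, DobricOjeda.IsDrivingBrownianMotion Z P H M W →
      ∀ ε : ℝ, 0 < ε → ∀ t : ℝ≥0,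
        MemLp (DobricOjeda.modifiedProcess P H M W ε t) 2 P ∧
        ∫ ω, DobricOjeda.modifiedProcess P H M W ε t ω ∂P = 0 ∧
        ((t : ℝ) ≤ ε →
          ∫ ω, DobricOjeda.modifiedProcess P H M W ε t ω ^ 2 ∂P =
            DobricOjeda.diffusionConst H ^ 2 * (t : ℝ) ^ (2 * (H : ℝ)) / (2 * (H : ℝ))) ∧
        (ε < (t : ℝ) →
          ∫ ω, DobricOjeda.modifiedProcess P H M W ε t ω ^ 2 ∂P =
            DobricOjeda.diffusionConst H ^ 2 / (2 * (H : ℝ)) * (t : ℝ) ^ (2 * (H : ℝ))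
            + 2 * DobricOjeda.diffusionConst H ^ 2 * (2 * (H : ℝ) - 1) * (1 / (2 * (H : ℝ)))
                * ((t : ℝ) ^ (2 * (H : ℝ)) - ε ^ (2 * (H : ℝ)))
            + 2 * DobricOjeda.cM H * DobricOjeda.cPsi H ^ 2 * (2 * (H : ℝ) - 1) ^ 2
                * (1 / (2 * (H : ℝ)) * ((t : ℝ) ^ (2 * (H : ℝ)) - ε ^ (2 * (H : ℝ)))
                  - ε / (2 * (H : ℝ) - 1)
                    * ((t : ℝ) ^ (2 * (H : ℝ) - 1) - ε ^ (2 * (H : ℝ) - 1)))) :=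
  ⟨DobricOjeda.exists_driving hZ hH hM, fun _ hW _ hε t ↦
    DobricOjeda.moments_modifiedProcess hZ hH hM hW hε t⟩
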